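/- Let $\Bbbk$ be a field and let $\mathcal F_V$ be the free symmetric operad over $\Bbbk$ generated by one binary operation $e_1=x_1x_2$ without symmetry; thus $V=\mathcal F_V(2)=\Bbbk e_1\oplus\Bbbk e_2$ with $e_2=(12)e_1=x_2x_1$, and $\mathcal F_V(n)$ is the multilinear part of degree $n$ of the free nonassociative algebra on $x_1,\dots,x_n$. For an $S_3$-submodule $R\subseteq\mathcal F_V(3)$ let $\mathcal P(V,R)=\mathcal F_V/(R)$ be the quotient by the operadic ideal generated by $R$. Let $\mathrm{As}$ be the associative operad, and for operads $\mathcal P,\mathcal Q$ let the white Manin product $\mathcal P\circ\mathcal Q$ be the binary quadratic operad generated by $\mathcal P(2)\otimes\mathcal Q(2)$ whose relations are the kernel of the natural map $\mathcal F_{\mathcal P(2)\otimes\mathcal Q(2)}(3)\to\mathcal P(3)\otimes\mathcal Q(3)$. For an operad $\mathrm{Var}$ generated by a binary operation $e_1$ and $e_2=(12)e_1$, the operad $\mathrm{As}\circ\mathrm{Var}$ is generated by $$g_1=x_1x_2\otimes e_2,\quad h_1=x_1x_2\otimes e_1,\quad g_2=(12)g_1,\quad h_2=(12)h_1,$$ and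 $\mathrm{Var}$ is said to admit a nonsymmetric version if, as operads, $$\mathrm{As}\circ\mathrm{Var}\big/\{g_1-h_2=0,\ g_2-h_1=0\}\cong\mathrm{Var}.$$ Lemma. For $\{i,j,l\}=\{1,2,3\}$ put $r(i,j,l)=(x_ix_j)x_l-x_i(x_jx_l)+x_j(x_ix_l)$. Let $R\subseteq\mathcal F_V(3)$ be the $S_3$-submodule generated by $r(1,2,3)$, so that $\mathrm{Leib}=\mathcal P(V,R)$. Let $U_0=\langle (x_1x_2)x_3,\ (x_2x_1)x_3,\ x_3(x_1x_2),\ x_3(x_2x_1)\rangle$, let $U_1=(13)U_0$, and let $F$ be the $S_3$-submodule of $\mathcal F_V(3)$ generated by $R\cap(U_0\oplus U_1)$. Then: 1. $R\cap(U_0\oplus U_1)$ is spanned by $r_1+r_2$ and $r_3+r_5$, where $r_1=r(1,2,3)$, $r_2=r(2,1,3)$, $r_3=r(3,2,1)$, $r_5=r(2,3,1)$; 2. $\dim\mathcal P(V,R)(3)<\dim\mathcal P(V,F)(3)$; 3. $\mathrm{Leib}$ does not admit a nonsymmetric version, i.e. $\mathrm{As}\circ\mathrm{Leib}\big/\{g_1-h_2=0,\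 g_2-h_1=0\}\not\cong\mathrm{Leib}$ as operads. -/

import Mathlib

open scoped TensorProduct

universe u

/-- A symmetric operad in vector spaces over `k`, in coordinate-free form: the arities are finite
sets (`P(n)` is `obj (Fin n)`), bijections of arities act by relabelling the inputs, and
`comp a b` is the total composition `a(b_i)_{i ∈ I}`, whose inputs are the pairs `(i, j)` with
`j` an input of `b_i`. -/
structure SymOperad (k : Type u) [Field k] where
  obj : (I : Type) → [Finite I] → Type u
  [addCommGroup : ∀ (I : Type) [Finite I], AddCommGroup (obj I)]
  [module : ∀ (I : Type) [Finite I], Module k (obj I)]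
  map : ∀ {I J : Type} [Finite I] [Finite J], (I ≃ J) → (obj I →ₗ[k] obj J)
  one : obj Unit
  comp : ∀ {I : Type} [Finite I] {J : I → Type} [∀ i, Finite (J i)],
    obj I →ₗ[k] MultilinearMap k (fun i => obj (J i)) (obj (Σ i, J i))
  map_refl : ∀ {I : Type} [Finite I] (a : obj I), map (Equiv.refl I) a = a
  map_trans : ∀ {I J K : Type} [Finite I] [Finite J] [Finite K] (e : I ≃ J) (f : J ≃ K)
    (a : obj I), map (e.trans f) a = map f (map e a)
  comp_map_right : ∀ {I : Type} [Finite I] {J J' : I → Type} [∀ i, Finite (J i)]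
    [∀ i, Finite (J' i)] (e : ∀ i, J i ≃ J' i) (a : obj I) (b : ∀ i, obj (J i)),
    comp a (fun i => map (e i) (b i)) = map (Equiv.sigmaCongrRight e) (comp a b)
  comp_map_left : ∀ {I I' : Type} [Finite I] [Finite I'] (e : I ≃ I') {J : I' → Type}
    [∀ i, Finite (J i)] (a : obj I) (b : ∀ i, obj (J i)),
    comp (map e a) b = map (Equiv.sigmaCongrLeft e) (comp a fun i => b (e i))
  one_comp : ∀ {J : Unit → Type} [∀ i, Finite (J i)] (b : ∀ i, obj (J i)),
    comp one b = map (Equiv.uniqueSigma J).symm (b ())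
  comp_one : ∀ {I : Type} [Finite I] (a : obj I),
    comp a (fun _ => one) = map (Equiv.sigmaUnique I fun _ => Unit).symm a
  comp_assoc : ∀ {I : Type} [Finite I] {J : I → Type} [∀ i, Finite (J i)]
    {K : ∀ i, J i → Type} [∀ i j, Finite (K i j)] (a : obj I) (b : ∀ i, obj (J i))
    (c : ∀ i j, obj (K i j)),
    comp (comp a b) (fun p : Σ i, J i => c p.1 p.2)
      = map (Equiv.sigmaAssoc K).symm (comp a fun i => comp (b i) (c i))

namespace SymOperad

attribute [instance] SymOperad.addCommGroup SymOperad.module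

variable {k : Type u} [Field k]

/-- An isomorphism of operads. -/
structure Iso (P Q : SymOperad k) where
  toEquiv : ∀ (I : Type) [Finite I], P.obj I ≃ₗ[k] Q.obj I
  map_map : ∀ {I J : Type} [Finite I] [Finite J] (e : I ≃ J) (a : P.obj I),
    toEquiv J (P.map e a) = Q.map e (toEquiv I a)
  map_one : toEquiv Unit P.one = Q.one
  map_comp : ∀ {I : Type} [Finite I] {J : I → Type} [∀ i, Finite (J i)] (a : P.obj I)
    (b : ∀ i, P.obj (J i)),
    toEquiv (Σ i, J i) (P.comp a b) = Q.comp (toEquiv I a) fun i => toEquiv (J i) (b i)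

/-! ### Operadic ideals and quotients -/

/-- A (two-sided) operadic ideal. -/
structure OpIdeal (P : SymOperad k) where
  carrier : ∀ (I : Type) [Finite I], Submodule k (P.obj I)
  map_mem : ∀ {I J : Type} [Finite I] [Finite J] (e : I ≃ J) {a : P.obj I},
    a ∈ carrier I → P.map e a ∈ carrier J
  comp_mem_left : ∀ {I : Type} [Finite I] {J : I → Type} [∀ i, Finite (J i)] {a : P.obj I}
    (b : ∀ i, P.obj (J i)), a ∈ carrier I → P.comp a b ∈ carrier (Σ i, J i)
  comp_mem_right : ∀ {I : Type} [Finite I] {J : I → Type} [∀ i, Finite (J i)] (a : P.obj I)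
    (b : ∀ i, P.obj (J i)) (i : I), b i ∈ carrier (J i) → P.comp a b ∈ carrier (Σ i, J i)

/-- The operadic ideal generated by a set `S` of relations (pairs of an arity and an element). -/
def idealSpan (P : SymOperad k) (S : Set (Σ n : ℕ, P.obj (Fin n))) : OpIdeal P where
  carrier I _ := ⨅ (K : OpIdeal P) (_ : ∀ x ∈ S, x.2 ∈ K.carrier (Fin x.1)), K.carrier I
  map_mem e a h := by
    simp only [Submodule.mem_iInf] at h ⊢
    exact fun K hK => K.map_mem e (h K hK)
  comp_mem_left b h := by
    simp only [Submodule.mem_iInf] at h ⊢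
    exact fun K hK => K.comp_mem_left b (h K hK)
  comp_mem_right a b i h := by
    simp only [Submodule.mem_iInf] at h ⊢
    exact fun K hK => K.comp_mem_right a b i (h K hK)

section QuotientMultilinear

variable {ι : Type} {M : ι → Type u} [∀ i, AddCommGroup (M i)] [∀ i, Module k (M i)]
  {N : Type u} [AddCommGroup N] [Module k N]

theorem multilinear_congr [Finite ι] (p : ∀ i, Submodule k (M i)) (f : MultilinearMap k M N)
    (hf : ∀ (b : ∀ i, M i) (i : ι), b i ∈ p i → f b = 0) (b b' : ∀ i, M i)
    (h : ∀ i, b i - b' i ∈ p i) : f b = f b' := by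
  classical
  cases nonempty_fintype ι
  have key : ∀ s : Finset ι, f (fun i => if i ∈ s then b' i else b i) = f b := by
    intro s
    induction s using Finset.induction_on with
    | empty => simp
    | insert j s hj ih =>
      rw [← ih]
      have e1 : (fun i => if i ∈ s then b' i else b i)
          = Function.update (fun i => if i ∈ s then b' i else b i) j (b j) := by
        rw [eq_comm, Function.update_eq_self_iff]; simp [hj]
      have e2 : (fun i => if i ∈ insert j s then b' i else b i)
          = Function.update (fun i => if i ∈ s then b' i else b i) j (b' j) := by
        funext i
        rcases eq_or_ne i j with rfl | hij
        · simp
        · simp [hij]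
      rw [e1, e2, eq_comm, ← sub_eq_zero, ← f.map_update_sub]
      refine hf _ j ?_
      simpa using h j
  have := key Finset.univ
  simpa using this.symm

/-- A multilinear map that vanishes as soon as one argument lies in `p i` descends to the
quotients `M i ⧸ p i`. -/
noncomputable def multilinearDescend [Finite ι] (p : ∀ i, Submodule k (M i))
    (f : MultilinearMap k M N) (hf : ∀ (b : ∀ i, M i) (i : ι), b i ∈ p i → f b = 0) :
    MultilinearMap k (fun i => M i ⧸ p i) N where
  toFun q := f fun i => (q i).out
  map_update_add' q i x y := by
    have H : ∀ z : M i ⧸ p i, (f fun j => (Function.update q i z j).out)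
        = f (Function.update (fun j => (q j).out) i z.out) := by
      intro z
      congr 1
      funext j
      rcases eq_or_ne j i with rfl | hj
      · simp
      · simp [hj]
    rw [H, H, H, ← f.map_update_add]
    refine multilinear_congr p f hf _ _ fun j => ?_
    rcases eq_or_ne j i with rfl | hj
    · simp [← Submodule.Quotient.mk_eq_zero]
    · simp [hj]
  map_update_smul' q i c x := by
    have H : ∀ z : M i ⧸ p i, (f fun j => (Function.update q i z j).out)
        = f (Function.update (fun j => (q j).out) i z.out) := by
      intro z
      congr 1
      funext j
      rcases eq_or_ne j i with rfl | hj
      · simp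
      · simp [hj]
    rw [H, H, ← f.map_update_smul]
    refine multilinear_congr p f hf _ _ fun j => ?_
    rcases eq_or_ne j i with rfl | hj
    · simp [← Submodule.Quotient.mk_eq_zero]
    · simp [hj]

theorem multilinearDescend_mk [Finite ι] (p : ∀ i, Submodule k (M i))
    (f : MultilinearMap k M N) (hf : ∀ (b : ∀ i, M i) (i : ι), b i ∈ p i → f b = 0)
    (b : ∀ i, M i) :
    multilinearDescend p f hf (fun i => (p i).mkQ (b i)) = f b := by
  refine multilinear_congr p f hf _ _ fun j => ?_
  simp [← Submodule.Quotient.mk_eq_zero]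

end QuotientMultilinear

/-- The composition of the quotient operad `P / K`. -/
noncomputable def quotientComp (P : SymOperad k) (K : OpIdeal P) {I : Type} [Finite I]
    {J : I → Type} [∀ i, Finite (J i)] :
    (P.obj I ⧸ K.carrier I) →ₗ[k] MultilinearMap k (fun i => P.obj (J i) ⧸ K.carrier (J i))
      (P.obj (Σ i, J i) ⧸ K.carrier (Σ i, J i)) :=
  (K.carrier I).liftQ
    { toFun := fun a => multilinearDescend (fun i => K.carrier (J i))
        ((K.carrier (Σ i, J i)).mkQ.compMultilinearMap (P.comp a)) (fun b i hb => by
          simpa using K.comp_mem_right a b i hb)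
      map_add' := fun a a' => by
        ext q
        simp [multilinearDescend]
      map_smul' := fun c a => by
        ext q
        simp [multilinearDescend] }
    (fun a ha => by
      rw [LinearMap.mem_ker]
      ext q
      simpa [multilinearDescend] using K.comp_mem_left _ ha)

theorem quotientComp_mk (P : SymOperad k) (K : OpIdeal P) {I : Type} [Finite I]
    {J : I → Type} [∀ i, Finite (J i)] (a : P.obj I) (b : ∀ i, P.obj (J i)) :
    quotientComp P K ((K.carrier I).mkQ a) (fun i => (K.carrier (J i)).mkQ (b i))
      = (K.carrier (Σ i, J i)).mkQ (P.comp a b) :=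
  multilinearDescend_mk (fun i => K.carrier (J i))
    ((K.carrier (Σ i, J i)).mkQ.compMultilinearMap (P.comp a))
    (fun b i hb => by simpa using K.comp_mem_right a b i hb) b

/-- The quotient of an operad by an operadic ideal. -/
noncomputable def quotient (P : SymOperad k) (K : OpIdeal P) : SymOperad k where
  obj I _ := P.obj I ⧸ K.carrier I
  map {I J} _ _ e := (K.carrier I).mapQ (K.carrier J) (P.map e) fun _ h => K.map_mem e h
  one := (K.carrier Unit).mkQ P.one
  comp := quotientComp P K
  map_refl a := by
    obtain ⟨a, rfl⟩ := Submodule.mkQ_surjective _ a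
    simp [P.map_refl]
  map_trans e f a := by
    obtain ⟨a, rfl⟩ := Submodule.mkQ_surjective _ a
    simp [P.map_trans]
  comp_map_right {I} _ {J J'} _ _ e a b := by
    obtain ⟨a, rfl⟩ := Submodule.mkQ_surjective _ a
    choose b' hb using fun i => Submodule.mkQ_surjective _ (b i)
    obtain rfl : (fun i => (K.carrier (J i)).mkQ (b' i)) = b := funext hb
    have := quotientComp_mk P K a fun i => P.map (e i) (b' i)
    rw [P.comp_map_right] at this
    rw [quotientComp_mk]
    simpa using this
  comp_map_left {I I'} _ _ e J _ a b := by
    obtain ⟨a, rfl⟩ := Submodule.mkQ_surjective _ a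
    choose b' hb using fun i => Submodule.mkQ_surjective _ (b i)
    obtain rfl : (fun i => (K.carrier (J i)).mkQ (b' i)) = b := funext hb
    have := quotientComp_mk P K (P.map e a) b'
    rw [P.comp_map_left] at this
    have h2 := quotientComp_mk P K a fun i => b' (e i)
    simp only [Submodule.mkQ_apply, Submodule.mapQ_apply] at this h2 ⊢
    rw [this, h2]; rfl
  one_comp {J} _ b := by
    choose b' hb using fun i => Submodule.mkQ_surjective _ (b i)
    obtain rfl : (fun i => (K.carrier (J i)).mkQ (b' i)) = b := funext hb
    rw [quotientComp_mk, P.one_comp]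
    rfl
  comp_one {I} _ a := by
    obtain ⟨a, rfl⟩ := Submodule.mkQ_surjective _ a
    rw [quotientComp_mk P K a fun _ => P.one, P.comp_one]
    rfl
  comp_assoc {I} _ {J} _ {L} _ a b c := by
    obtain ⟨a, rfl⟩ := Submodule.mkQ_surjective _ a
    choose b' hb using fun i => Submodule.mkQ_surjective _ (b i)
    obtain rfl : (fun i => (K.carrier (J i)).mkQ (b' i)) = b := funext hb
    choose c' hc using fun i j => Submodule.mkQ_surjective _ (c i j)
    obtain rfl : (fun i j => (K.carrier (L i j)).mkQ (c' i j)) = c :=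
      funext fun i => funext fun j => hc i j
    rw [quotientComp_mk, quotientComp_mk P K (P.comp a b') fun p => c' p.1 p.2, P.comp_assoc]
    simp only [quotientComp_mk]
    rfl

/-- The class of an element of `P` in `P / K`. -/
noncomputable def toQuotient (P : SymOperad k) (K : OpIdeal P) (I : Type) [Finite I] :
    P.obj I →ₗ[k] (P.quotient K).obj I :=
  (K.carrier I).mkQ

end SymOperad

/-! ### The free operad on a set of binary operations -/

/-- Planar binary trees with leaves labelled by `I` and internal vertices labelled by `B`, i.e.
nonassociative monomials in the variables `I` and the binary operations `B`. -/
inductive BTree (B : Type u) (I : Type) : Type u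
  | leaf (i : I) : BTree B I
  | node (b : B) (t : Fin 2 → BTree B I) : BTree B I

namespace BTree

variable {B : Type u} {I J K : Type}

/-- The set of leaves of a tree. -/
def Pos : BTree B I → Type
  | leaf _ => Unit
  | node _ t => Σ c : Fin 2, (t c).Pos

/-- The label of a leaf. -/
def label : (t : BTree B I) → t.Pos → I
  | leaf i, _ => i
  | node _ t, p => (t p.1).label p.2

instance finite_pos : (t : BTree B I) → Finite t.Pos
  | leaf _ => inferInstanceAs (Finite Unit)
  | node _ t =>
    have : ∀ c, Finite (t c).Pos := fun c => finite_pos (t c)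
    inferInstanceAs (Finite (Σ c : Fin 2, (t c).Pos))

/-- Substitution of trees for the leaves. -/
def bind : BTree B I → (I → BTree B J) → BTree B J
  | leaf i, f => f i
  | node b t, f => node b fun c => (t c).bind f

theorem bind_leaf (t : BTree B I) : t.bind leaf = t := by
  induction t with
  | leaf i => rfl
  | node b t ih => simp [bind, ih]

theorem bind_bind (t : BTree B I) (f : I → BTree B J) (g : J → BTree B K) :
    (t.bind f).bind g = t.bind fun i => (f i).bind g := by
  induction t with
  | leaf i => rfl
  | node b t ih => simp [bind, ih]

/-- The leaves of a substituted tree. -/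
def bindPos : (t : BTree B I) → (f : I → BTree B J) →
    (t.bind f).Pos ≃ Σ p : t.Pos, (f (t.label p)).Pos
  | leaf i, f => (Equiv.uniqueSigma fun _ : Unit => (f i).Pos).symm
  | node _ t, f => (Equiv.sigmaCongrRight fun c => bindPos (t c) f).trans
      (Equiv.sigmaAssoc fun c p => (f ((t c).label p)).Pos).symm

theorem label_bindPos (t : BTree B I) (f : I → BTree B J) (p : (t.bind f).Pos) :
    (t.bind f).label p = (f (t.label (bindPos t f p).1)).label (bindPos t f p).2 := by
  induction t with
  | leaf i => rfl
  | node b t ih => exact ih p.1 p.2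

theorem bijective_label_bind (t : BTree B I) (f : I → BTree B J)
    (h : Function.Bijective
      fun x : Σ p : t.Pos, (f (t.label p)).Pos => (f (t.label x.1)).label x.2) :
    Function.Bijective (t.bind f).label := by
  have : (t.bind f).label
      = (fun x : Σ p : t.Pos, (f (t.label p)).Pos => (f (t.label x.1)).label x.2)
        ∘ bindPos t f := funext (label_bindPos t f)
  rw [this]
  exact h.comp (bindPos t f).bijective

theorem bijective_label_relabel (e : I ≃ J) (t : BTree B I) (h : Function.Bijective t.label) :
    Function.Bijective (t.bind fun i => leaf (B := B) (e i)).label := by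
  refine bijective_label_bind t _ ⟨?_, ?_⟩
  · rintro ⟨p, ⟨⟩⟩ ⟨q, ⟨⟩⟩ hpq
    have : p = q := h.1 (e.injective hpq)
    subst this
    rfl
  · intro j
    obtain ⟨p, hp⟩ := h.2 (e.symm j)
    exact ⟨⟨p, ()⟩, by simp [label, hp]⟩

theorem bijective_label_subst {J : I → Type} (t : BTree B I) (u : ∀ i, BTree B (J i))
    (h : Function.Bijective t.label) (hu : ∀ i, Function.Bijective (u i).label) :
    Function.Bijective
      (t.bind fun i => (u i).bind fun j => leaf (B := B) (Sigma.mk i j)).label := by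
  refine bijective_label_bind t _ ⟨?_, ?_⟩
  · rintro ⟨p, x⟩ ⟨q, y⟩ hpq
    simp only [label_bindPos, label, Sigma.mk.injEq] at hpq
    have : p = q := h.1 hpq.1
    subst this
    congr 1
    apply (bindPos _ _).injective
    have h2 := (hu _).1 (eq_of_heq hpq.2)
    exact Sigma.ext h2 (heq_of_eq_cast (by rw [h2]) rfl)
  · rintro ⟨i, j⟩
    obtain ⟨p, rfl⟩ := h.2 i
    obtain ⟨q, rfl⟩ := (hu _).2 j
    refine ⟨⟨p, (bindPos (u (t.label p)) _).symm ⟨q, ()⟩⟩, ?_⟩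
    simp [label_bindPos, label]

end BTree

/-- Multilinear monomials: every variable in `I` occurs exactly once. -/
structure MTree (B : Type u) (I : Type) : Type u where
  tree : BTree B I
  bijective_label : Function.Bijective tree.label

namespace MTree

variable {B : Type u} {I J K : Type}

theorem ext {s t : MTree B I} (h : s.1 = t.1) : s = t := by
  cases s
  cases t
  cases h
  rfl

/-- The monomial `b(x_0, x_1)`. -/
def corolla (b : B) : MTree B (Fin 2) :=
  ⟨.node b BTree.leaf, ⟨fun _ _ h => Sigma.ext h (by rfl), fun i => ⟨⟨i, ()⟩, rfl⟩⟩⟩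

/-- The trivial monomial. -/
def triv : MTree B Unit :=
  ⟨.leaf (), ⟨fun _ _ _ => rfl, fun _ => ⟨(), rfl⟩⟩⟩

/-- Renaming of the variables. -/
def relabel (e : I ≃ J) (t : MTree B I) : MTree B J :=
  ⟨t.1.bind fun i => .leaf (e i), BTree.bijective_label_relabel e t.1 t.2⟩

/-- Simultaneous substitution of multilinear monomials in disjoint sets of variables. -/
def subst {J : I → Type} (t : MTree B I) (u : ∀ i, MTree B (J i)) : MTree B (Σ i, J i) :=
  ⟨t.1.bind fun i => (u i).1.bind fun j => .leaf ⟨i, j⟩,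
    BTree.bijective_label_subst t.1 (fun i => (u i).1) t.2 fun i => (u i).2⟩

theorem relabel_refl (t : MTree B I) : t.relabel (Equiv.refl I) = t :=
  ext (BTree.bind_leaf t.1)

theorem relabel_trans (e : I ≃ J) (f : J ≃ K) (t : MTree B I) :
    t.relabel (e.trans f) = (t.relabel e).relabel f :=
  ext (BTree.bind_bind t.1 (fun i => .leaf (e i)) fun j => .leaf (f j)).symm

theorem subst_relabel {J J' : I → Type} (e : ∀ i, J i ≃ J' i) (t : MTree B I)
    (u : ∀ i, MTree B (J i)) :
    t.subst (fun i => (u i).relabel (e i)) = (t.subst u).relabel (Equiv.sigmaCongrRight e) := by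
  apply ext
  simp only [subst, relabel, BTree.bind_bind]
  rfl

theorem relabel_subst {I' : Type} (e : I ≃ I') {J : I' → Type} (t : MTree B I)
    (u : ∀ i, MTree B (J i)) :
    (t.relabel e).subst u = (t.subst fun i => u (e i)).relabel (Equiv.sigmaCongrLeft e) := by
  apply ext
  simp only [subst, relabel, BTree.bind_bind]
  rfl

theorem triv_subst {J : Unit → Type} (u : ∀ i, MTree B (J i)) :
    triv.subst u = (u ()).relabel (Equiv.uniqueSigma J).symm := rfl

theorem subst_triv (t : MTree B I) :
    t.subst (fun _ => triv) = t.relabel (Equiv.sigmaUnique I fun _ => Unit).symm := rfl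

theorem subst_assoc {J : I → Type} {K : ∀ i, J i → Type} (t : MTree B I)
    (u : ∀ i, MTree B (J i)) (v : ∀ i j, MTree B (K i j)) :
    (t.subst u).subst (fun p : Σ i, J i => v p.1 p.2)
      = (t.subst fun i => (u i).subst (v i)).relabel (Equiv.sigmaAssoc K).symm := by
  apply ext
  simp only [subst, relabel, BTree.bind_bind]
  rfl

end MTree

section FreeOperad

variable (k : Type u) [Field k] (B : Type u)

/-- The multilinear map `(b_i)_i ↦ ⨂_i b_i` from finitely supported functions on the `X i` to
finitely supported functions on `∀ i, X i`. -/
noncomputable def finsuppProd {I : Type} [Finite I] (X : I → Type u) :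
    MultilinearMap k (fun i => X i →₀ k) ((∀ i, X i) →₀ k) :=
  letI := Classical.decEq I
  letI := Fintype.ofFinite I
  { toFun := fun b => Finsupp.onFinset (Fintype.piFinset fun i => (b i).support)
      (fun u => ∏ i, b i (u i)) (fun u hu => by
        simp only [Fintype.mem_piFinset, Finsupp.mem_support_iff]
        exact fun i hi => hu (Finset.prod_eq_zero (Finset.mem_univ i) hi))
    map_update_add' := fun {dec} b i x y => by
      obtain rfl : dec = Classical.decEq I := Subsingleton.elim _ _
      ext u
      have H : ∀ z : X i →₀ k, ∏ j, Function.update b i z j (u j)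
          = z (u i) * ∏ j ∈ Finset.univ.erase i, b j (u j) := by
        intro z
        rw [← Finset.mul_prod_erase _ _ (Finset.mem_univ i)]
        refine congrArg₂ _ (by simp) (Finset.prod_congr rfl fun j hj => ?_)
        rw [Function.update_of_ne (Finset.ne_of_mem_erase hj)]
      simp only [Finsupp.onFinset_apply, Finsupp.add_apply, H, add_mul]
    map_update_smul' := fun {dec} b i c x => by
      obtain rfl : dec = Classical.decEq I := Subsingleton.elim _ _
      ext u
      have H : ∀ z : X i →₀ k, ∏ j, Function.update b i z j (u j)
          = z (u i) * ∏ j ∈ Finset.univ.erase i, b j (u j) := by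
        intro z
        rw [← Finset.mul_prod_erase _ _ (Finset.mem_univ i)]
        refine congrArg₂ _ (by simp) (Finset.prod_congr rfl fun j hj => ?_)
        rw [Function.update_of_ne (Finset.ne_of_mem_erase hj)]
      simp only [Finsupp.onFinset_apply, Finsupp.smul_apply, H, smul_eq_mul, mul_assoc] }

theorem finsuppProd_apply {I : Type} [Fintype I] (X : I → Type u) (b : ∀ i, X i →₀ k)
    (u : ∀ i, X i) : finsuppProd k X b u = ∏ i, b i (u i) := by
  simp only [finsuppProd, MultilinearMap.coe_mk, Finsupp.onFinset_apply]
  congr!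

theorem finsuppProd_single {I : Type} [Finite I] (X : I → Type u) (u : ∀ i, X i) :
    finsuppProd k X (fun i => Finsupp.single (u i) 1) = Finsupp.single u 1 := by
  classical
  cases nonempty_fintype I
  ext v
  rw [finsuppProd_apply, Finsupp.single_apply]
  simp only [Finsupp.single_apply, Finset.prod_ite_zero]
  simp [funext_iff]

theorem finsupp_linear_ext {X N : Type u} [AddCommGroup N] [Module k N]
    (f g : (X →₀ k) →ₗ[k] N) (h : ∀ x, f (Finsupp.single x 1) = g (Finsupp.single x 1)) :
    f = g :=
  Finsupp.basisSingleOne.ext fun x => by simpa using h x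

theorem finsupp_multilinear_ext {I : Type} [Finite I] {X : I → Type u} {N : Type u}
    [AddCommGroup N] [Module k N] (f g : MultilinearMap k (fun i => X i →₀ k) N)
    (h : ∀ x : ∀ i, X i, f (fun i => Finsupp.single (x i) 1)
      = g (fun i => Finsupp.single (x i) 1)) : f = g :=
  Module.Basis.ext_multilinear (fun _ => Finsupp.basisSingleOne) fun x => by simpa using h x

theorem finsuppProd_mapDomain {I : Type} [Finite I] {X Y : I → Type u} (f : ∀ i, X i → Y i)
    (b : ∀ i, X i →₀ k) :
    finsuppProd k Y (fun i => Finsupp.lmapDomain k k (f i) (b i))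
      = Finsupp.lmapDomain k k (fun u i => f i (u i)) (finsuppProd k X b) := by
  refine congr($(finsupp_multilinear_ext k
    ((finsuppProd k Y).compLinearMap fun i => Finsupp.lmapDomain k k (f i))
    ((Finsupp.lmapDomain k k fun u i => f i (u i)).compMultilinearMap (finsuppProd k X)) ?_) b)
  intro x
  simp [finsuppProd_single]

theorem finsuppProd_curry {I : Type} [Finite I] {J : I → Type} [∀ i, Finite (J i)]
    {X : ∀ i, J i → Type u} (c : ∀ i j, X i j →₀ k) :
    finsuppProd k (fun i => ∀ j, X i j) (fun i => finsuppProd k (X i) (c i))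
      = Finsupp.lmapDomain k k (fun u i j => u ⟨i, j⟩)
        (finsuppProd k (fun p : Σ i, J i => X p.1 p.2) fun p => c p.1 p.2) := by
  cases nonempty_fintype I
  have := fun i => Fintype.ofFinite (J i)
  ext v
  have hv : v = Equiv.piCurry X (fun p => v p.1 p.2) := rfl
  have h2 : (fun (u : ∀ p : Σ i, J i, X p.1 p.2) i j => u ⟨i, j⟩) = Equiv.piCurry X := rfl
  rw [Finsupp.lmapDomain_apply, h2]
  conv_rhs => rw [hv]
  rw [Finsupp.mapDomain_apply (Equiv.injective _), finsuppProd_apply, finsuppProd_apply,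
    Fintype.prod_sigma]
  exact Finset.prod_congr rfl fun i _ => finsuppProd_apply k _ _ _

theorem finsuppProd_reindex {I I' : Type} [Finite I] [Finite I'] (e : I ≃ I') {X : I' → Type u}
    (b : ∀ i, X i →₀ k) :
    finsuppProd k (fun i => X (e i)) (fun i => b (e i))
      = Finsupp.lmapDomain k k (fun u i => u (e i)) (finsuppProd k X b) := by
  cases nonempty_fintype I
  cases nonempty_fintype I'
  ext v
  obtain ⟨w, rfl⟩ := (Equiv.piCongrLeft X e).symm.surjective v
  have h2 : (fun (u : ∀ i, X i) i => u (e i)) = (Equiv.piCongrLeft X e).symm := rfl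
  rw [Finsupp.lmapDomain_apply, h2, Finsupp.mapDomain_apply (Equiv.injective _),
    finsuppProd_apply, finsuppProd_apply]
  exact Fintype.prod_equiv e _ _ fun i => rfl

theorem finsuppProd_unit {X : Unit → Type u} (b : ∀ i, X i →₀ k) :
    Finsupp.lmapDomain k k (fun u => u ()) (finsuppProd k X b) = b () := by
  ext v
  obtain ⟨w, rfl⟩ := (Equiv.piUnique X).surjective v
  have h2 : (fun (u : ∀ i, X i) => u ()) = Equiv.piUnique X := rfl
  rw [Finsupp.lmapDomain_apply, h2, Finsupp.mapDomain_apply (Equiv.injective _),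
    finsuppProd_apply]
  simp

/-- Evaluation of multilinear maps at `c`. -/
def evalMultilinear {ι : Type} {M : ι → Type u} {N : Type u} [∀ i, AddCommGroup (M i)]
    [∀ i, Module k (M i)] [AddCommGroup N] [Module k N] (c : ∀ i, M i) :
    MultilinearMap k M N →ₗ[k] N where
  toFun f := f c
  map_add' _ _ := rfl
  map_smul' _ _ := rfl

/-- Composition in the free operad: the multilinear extension of substitution of monomials. -/
noncomputable def freeComp {I : Type} [Finite I] {J : I → Type} [∀ i, Finite (J i)] :
    (MTree B I →₀ k) →ₗ[k]
      MultilinearMap k (fun i => MTree B (J i) →₀ k) (MTree B (Σ i, J i) →₀ k) :=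
  Finsupp.linearCombination k fun t : MTree B I =>
    (Finsupp.lmapDomain k k t.subst).compMultilinearMap (finsuppProd k fun i => MTree B (J i))

theorem freeComp_single_left {I : Type} [Finite I] {J : I → Type} [∀ i, Finite (J i)]
    (t : MTree B I) (c : k) (b : ∀ i, MTree B (J i) →₀ k) :
    freeComp k B (Finsupp.single t c) b
      = c • Finsupp.lmapDomain k k t.subst (finsuppProd k (fun i => MTree B (J i)) b) := by
  simp [freeComp]

theorem freeComp_single {I : Type} [Finite I] {J : I → Type} [∀ i, Finite (J i)]
    (t : MTree B I) (u : ∀ i, MTree B (J i)) :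
    freeComp k B (Finsupp.single t 1) (fun i => Finsupp.single (u i) 1)
      = Finsupp.single (t.subst u) 1 := by
  simp [freeComp, finsuppProd_single]

/-- The free symmetric operad on a set `B` of binary operations without symmetries. Its component
of arity `I` consists of the linear combinations of multilinear monomials in the variables `I`. -/
noncomputable def freeOperad : SymOperad k where
  obj I _ := MTree B I →₀ k
  map e := Finsupp.lmapDomain k k (MTree.relabel e)
  one := Finsupp.single MTree.triv 1
  comp := freeComp k B
  map_refl {I} _ a := by
    have : MTree.relabel (B := B) (Equiv.refl I) = id := funext MTree.relabel_refl
    simp [this]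
  map_trans e f a := by
    have : MTree.relabel (B := B) (e.trans f) = MTree.relabel f ∘ MTree.relabel e :=
      funext (MTree.relabel_trans e f)
    simp [this, Finsupp.mapDomain_comp]
  comp_map_right {I} _ {J J'} _ _ e a b := by
    induction a using Finsupp.induction_linear with
    | zero => simp
    | add a a' h h' => simp only [map_add, add_apply, h, h']
    | single t c =>
      rw [freeComp_single_left, freeComp_single_left, finsuppProd_mapDomain, map_smul]
      simp only [Finsupp.lmapDomain_apply, ← Finsupp.mapDomain_comp]
      congr 2
      exact funext fun u => MTree.subst_relabel e t u
  comp_map_left {I I'} _ _ e J _ a b := by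
    induction a using Finsupp.induction_linear with
    | zero => simp
    | add a a' h h' => simp only [map_add, add_apply, h, h']
    | single t c =>
      rw [Finsupp.lmapDomain_apply, Finsupp.mapDomain_single, freeComp_single_left,
        freeComp_single_left, map_smul]
      rw [finsuppProd_reindex k e b]
      simp only [Finsupp.lmapDomain_apply, ← Finsupp.mapDomain_comp]
      congr 2
      exact funext fun u => MTree.relabel_subst e t u
  one_comp {J} _ b := by
    rw [freeComp_single_left, one_smul, ← finsuppProd_unit k b]
    simp only [Finsupp.lmapDomain_apply, ← Finsupp.mapDomain_comp]
    rfl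
  comp_one {I} _ a := by
    induction a using Finsupp.induction_linear with
    | zero => simp
    | add a a' h h' => simp only [map_add, add_apply, h, h']
    | single t c =>
      rw [freeComp_single_left, finsuppProd_single]
      simp [MTree.subst_triv]
  comp_assoc {I} _ {J} _ {K} _ a b c := by
    induction a using Finsupp.induction_linear with
    | zero => simp
    | add a a' h h' => simp only [map_add, add_apply, h, h']
    | single t r =>
      rw [← mul_one r, ← smul_eq_mul, ← Finsupp.smul_single]
      simp only [map_smul, smul_apply]
      congr 1
      refine congr($(finsupp_multilinear_ext k
        ((evalMultilinear k (fun p : Σ i, J i => c p.1 p.2) ∘ₗ freeComp k B).compMultilinearMap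
          (freeComp k B (Finsupp.single t 1)))
        ((Finsupp.lmapDomain k k (MTree.relabel (Equiv.sigmaAssoc K).symm)).compMultilinearMap
          ((freeComp k B (Finsupp.single t 1)).compLinearMap fun i =>
            evalMultilinear k (c i) ∘ₗ freeComp k B)) ?_) b)
      intro u
      simp only [LinearMap.compMultilinearMap_apply, LinearMap.comp_apply,
        MultilinearMap.compLinearMap_apply, freeComp_single]
      simp only [evalMultilinear, LinearMap.coe_mk, AddHom.coe_mk, freeComp_single_left, one_smul]
      rw [finsuppProd_mapDomain, finsuppProd_curry]
      simp only [Finsupp.lmapDomain_apply, ← Finsupp.mapDomain_comp]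
      congr 1
      exact funext fun v => MTree.subst_assoc t u fun i j => v ⟨i, j⟩

end FreeOperad

/-! ### White Manin products -/

namespace SymOperad

variable {k : Type u} [Field k]

/-- Evaluation of a tree in an operad `P`, the vertex label `b` being interpreted as the binary
operation `g b`. -/
noncomputable def evalTree (P : SymOperad k) {B : Type u} {I : Type} (g : B → P.obj (Fin 2)) :
    (t : BTree B I) → P.obj t.Pos
  | .leaf _ => P.one
  | .node b t => P.comp (J := fun c => (t c).Pos) (g b) fun c => evalTree P g (t c)

/-- Evaluation of a multilinear monomial in an operad `P`. -/
noncomputable def eval (P : SymOperad k) {B : Type u} {I : Type} [Finite I]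
    (g : B → P.obj (Fin 2)) (t : MTree B I) : P.obj I :=
  P.map (Equiv.ofBijective t.1.label t.2) (P.evalTree g t.1)

/-- The natural map from the free operad on the binary operations `p ⊗ q`, `p ∈ P(2)`, `q ∈ Q(2)`,
to the componentwise tensor product `P(I) ⊗ Q(I)`. -/
noncomputable def evalTensor (P Q : SymOperad k) (I : Type) [Finite I] :
    (freeOperad k (P.obj (Fin 2) × Q.obj (Fin 2))).obj I →ₗ[k] P.obj I ⊗[k] Q.obj I :=
  Finsupp.linearCombination k fun t : MTree (P.obj (Fin 2) × Q.obj (Fin 2)) I =>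
    P.eval Prod.fst t ⊗ₜ[k] Q.eval Prod.snd t

/-- The white Manin product: the binary quadratic operad generated by `P(2) ⊗ Q(2)` with the
relations that hold in `P(3) ⊗ Q(3)`. It is presented by one binary operation for each pure tensor
`p ⊗ q`; the relations in arity two are exactly those making the space of generators the
`S₂`-module `P(2) ⊗ Q(2)`, and those in arity three form the kernel of the natural map to
`P(3) ⊗ Q(3)`. -/
noncomputable def whiteProduct (P Q : SymOperad k) : SymOperad k :=
  (freeOperad k (P.obj (Fin 2) × Q.obj (Fin 2))).quotient (idealSpan _
    {x | (x.1 = 2 ∨ x.1 = 3) ∧ evalTensor P Q (Fin x.1) x.2 = 0})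

/-- The generator `p ⊗ q` of the white Manin product. -/
noncomputable def whiteGen (P Q : SymOperad k) (p : P.obj (Fin 2)) (q : Q.obj (Fin 2)) :
    (whiteProduct P Q).obj (Fin 2) :=
  toQuotient _ _ (Fin 2) (Finsupp.single (MTree.corolla (p, q)) (1 : k))

end SymOperad

/-! ### Operads with one binary operation -/

section OneOperation

variable (k : Type u) [Field k]

/-- The free operad on one binary operation `x_0 x_1` without symmetry, i.e. the multilinear part
of free nonassociative algebras. It is `F_V` for `V` the regular representation of `S₂`, with basis
`e₁ = x_0 x_1`, `e₂ = x_1 x_0`. -/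
noncomputable abbrev magOperad : SymOperad k := freeOperad k PUnit.{u + 1}

theorem bijective_label_left {i j l : Fin 3} (h : [i, j, l].Nodup) :
    Function.Bijective (BTree.node PUnit.unit.{u + 1}
      ![.node PUnit.unit ![.leaf i, .leaf j], .leaf l]).label := by
  have hs : ∀ i j l : Fin 3, [i, j, l].Nodup → ∀ m, m = i ∨ m = j ∨ m = l := by decide
  have hij : i ≠ j := by rintro rfl; simp at h
  have hil : i ≠ l := by rintro rfl; simp at h
  have hjl : j ≠ l := by rintro rfl; simp at h
  constructor
  · rintro ⟨c, p⟩ ⟨d, q⟩ hpq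
    fin_cases c <;> fin_cases d
    · obtain ⟨c, p⟩ := p
      obtain ⟨d, q⟩ := q
      fin_cases c <;> fin_cases d
      · rfl
      · exact absurd hpq hij
      · exact absurd hpq hij.symm
      · rfl
    · obtain ⟨c, p⟩ := p
      fin_cases c
      · exact absurd hpq hil
      · exact absurd hpq hjl
    · obtain ⟨c, p⟩ := q
      fin_cases c
      · exact absurd hpq hil.symm
      · exact absurd hpq hjl.symm
    · rfl
  · intro m
    rcases hs i j l h m with rfl | rfl | rfl
    · exact ⟨⟨0, ⟨0, ()⟩⟩, rfl⟩
    · exact ⟨⟨0, ⟨1, ()⟩⟩, rfl⟩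
    · exact ⟨⟨1, ()⟩, rfl⟩

theorem bijective_label_right {i j l : Fin 3} (h : [i, j, l].Nodup) :
    Function.Bijective (BTree.node PUnit.unit.{u + 1}
      ![.leaf i, .node PUnit.unit ![.leaf j, .leaf l]]).label := by
  have hs : ∀ i j l : Fin 3, [i, j, l].Nodup → ∀ m, m = i ∨ m = j ∨ m = l := by decide
  have hij : i ≠ j := by rintro rfl; simp at h
  have hil : i ≠ l := by rintro rfl; simp at h
  have hjl : j ≠ l := by rintro rfl; simp at h
  constructor
  · rintro ⟨c, p⟩ ⟨d, q⟩ hpq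
    fin_cases c <;> fin_cases d
    · rfl
    · obtain ⟨c, p⟩ := q
      fin_cases c
      · exact absurd hpq hij
      · exact absurd hpq hil
    · obtain ⟨c, p⟩ := p
      fin_cases c
      · exact absurd hpq hij.symm
      · exact absurd hpq hil.symm
    · obtain ⟨c, p⟩ := p
      obtain ⟨d, q⟩ := q
      fin_cases c <;> fin_cases d
      · rfl
      · exact absurd hpq hjl
      · exact absurd hpq hjl.symm
      · rfl
  · intro m
    rcases hs i j l h m with rfl | rfl | rfl
    · exact ⟨⟨0, ()⟩, rfl⟩
    · exact ⟨⟨1, ⟨0, ()⟩⟩, rfl⟩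
    · exact ⟨⟨1, ⟨1, ()⟩⟩, rfl⟩

/-- The monomial `(x_i x_j) x_l`. -/
noncomputable def lmon (i j l : Fin 3) (h : [i, j, l].Nodup := by decide) :
    (magOperad k).obj (Fin 3) :=
  Finsupp.single (⟨_, bijective_label_left h⟩ : MTree PUnit.{u + 1} (Fin 3)) (1 : k)

/-- The monomial `x_i (x_j x_l)`. -/
noncomputable def rmon (i j l : Fin 3) (h : [i, j, l].Nodup := by decide) :
    (magOperad k).obj (Fin 3) :=
  Finsupp.single (⟨_, bijective_label_right h⟩ : MTree PUnit.{u + 1} (Fin 3)) (1 : k)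

/-- The `S₃`-submodule of `F_V(3)` generated by a set. -/
noncomputable def symSpan (S : Set ((magOperad k).obj (Fin 3))) :
    Submodule k ((magOperad k).obj (Fin 3)) :=
  Submodule.span k {y | ∃ (σ : Equiv.Perm (Fin 3)) (x : _), x ∈ S ∧ y = (magOperad k).map σ x}

/-- The binary quadratic operad `P(V, R)` generated by one binary operation, with space of
relations `R ⊆ F_V(3)`. -/
noncomputable def quadraticOperad (R : Submodule k ((magOperad k).obj (Fin 3))) : SymOperad k :=
  (magOperad k).quotient (SymOperad.idealSpan _ {x | ∃ r ∈ R, x = ⟨3, r⟩})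

/-- The generating operation `e₁ = x_0 x_1` of `P(V, R)`. -/
noncomputable def quadraticGen (R : Submodule k ((magOperad k).obj (Fin 3))) :
    (quadraticOperad k R).obj (Fin 2) :=
  SymOperad.toQuotient _ _ (Fin 2) (Finsupp.single (MTree.corolla PUnit.unit) (1 : k))

/-- The space of relations of the associative operad. -/
noncomputable def asRel : Submodule k ((magOperad k).obj (Fin 3)) :=
  symSpan k {lmon k 0 1 2 - rmon k 0 1 2}

/-- The operad of associative algebras. -/
noncomputable abbrev asOperad : SymOperad k := quadraticOperad k (asRel k)

/-- The Leibniz element `(x_i x_j) x_l - x_i (x_j x_l) + x_j (x_i x_l)`. -/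
noncomputable def leibElt (i j l : Fin 3) (h : [i, j, l].Nodup := by decide) :
    (magOperad k).obj (Fin 3) :=
  lmon k i j l h - rmon k i j l h + rmon k j i l (List.Perm.nodup (.swap j i [l]) h)

/-- The space of relations of the Leibniz operad. -/
noncomputable def leibRel : Submodule k ((magOperad k).obj (Fin 3)) :=
  symSpan k {leibElt k 0 1 2}

/-- The operad of (left) Leibniz algebras. -/
noncomputable abbrev leibOperad : SymOperad k := quadraticOperad k (leibRel k)

/-- `U₀ = V ⊗ V ⊆ F_V(3)`, spanned by the monomials in which `x_2` is multiplied with a product of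
`x_0` and `x_1`. -/
noncomputable def U₀ : Submodule k ((magOperad k).obj (Fin 3)) :=
  Submodule.span k {lmon k 0 1 2, lmon k 1 0 2, rmon k 2 0 1, rmon k 2 1 0}

/-- The image `U₁` of `U₀` under the transposition of `x_0` and `x_2`. -/
noncomputable def U₁ : Submodule k ((magOperad k).obj (Fin 3)) :=
  (U₀ k).map ((magOperad k).map (Equiv.swap 0 2))

/-- The `S₃`-submodule `F` generated by `R ∩ (U₀ ⊕ U₁)`. -/
noncomputable def criterionSubmodule (R : Submodule k ((magOperad k).obj (Fin 3))) :
    Submodule k ((magOperad k).obj (Fin 3)) :=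
  symSpan k ((R ⊓ (U₀ k ⊔ U₁ k) : Submodule k ((magOperad k).obj (Fin 3))) : Set _)

end OneOperation

/-! ### Nonsymmetric versions -/

section Nonsymmetric

variable (k : Type u) [Field k] (P : SymOperad k) (e : P.obj (Fin 2))

/-- The generator `g₁ = x_0 x_1 ⊗ e₂` of `As ∘ P`, where `e₂ = (01) e`. -/
noncomputable def genG : ((asOperad k).whiteProduct P).obj (Fin 2) :=
  SymOperad.whiteGen _ _ (quadraticGen k (asRel k)) (P.map (Equiv.swap 0 1) e)

/-- The generator `h₁ = x_0 x_1 ⊗ e₁` of `As ∘ P`, where `e₁ = e`. -/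
noncomputable def genH : ((asOperad k).whiteProduct P).obj (Fin 2) :=
  SymOperad.whiteGen _ _ (quadraticGen k (asRel k)) e

/-- The quotient of `As ∘ P` by `g₁ = h₂` and `g₂ = h₁`, where `g₂ = (01) g₁` and
`h₂ = (01) h₁`. -/
noncomputable def identifiedOperad : SymOperad k :=
  ((asOperad k).whiteProduct P).quotient (SymOperad.idealSpan _
    {⟨2, genG k P e - ((asOperad k).whiteProduct P).map (Equiv.swap 0 1) (genH k P e)⟩,
     ⟨2, ((asOperad k).whiteProduct P).map (Equiv.swap 0 1) (genG k P e) - genH k P e⟩})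

/-- An operad `P` generated by the binary operation `e` (and its opposite) admits a nonsymmetric
version if identifying `g₁ = h₂` and `g₂ = h₁` in `As ∘ P` recovers `P` up to isomorphism. -/
def AdmitsNonsymmetricVersion : Prop :=
  Nonempty (SymOperad.Iso (identifiedOperad k P e) P)

end Nonsymmetric

/-! ### Algebras over operads -/

section TreeEval

variable {k : Type u} [Field k] {A : Type u} [AddCommGroup A] [Module k A] {B : Type u}
  {I J : Type}

/-! In Leib the relation rewrites `(x_i x_j) x_l` as `x_i (x_j x_l) - x_j (x_i x_l)`, so the six
right-normed monomials span arity three and dim Leib(3) ≤ 6 (`finrank_leibOperad_three_le`). For the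
two larger operads it is enough to exhibit an algebra on which seven elements of arity three act
independently, and one algebra serves both: `CritAlg` with the product `critMul`, which satisfies
(ab + ba)c = 0 while keeping a left-normed product independent of the six right-normed ones.

For P(V, F): comparing coefficients of the four monomials outside U₀ and U₁ gives the two generators
of the intersection (`leibRel_inf`). In r(i,j,l) + r(j,i,l) the right-normed terms cancel, so F
amounts to the identity (ab + ba)c = 0, and `seven_le_finrank` applies.

For As ∘ Leib: the element p ⊗ q acts on `CritAlg` as q does, scaled by the sum of the coefficients
of p; hence g₁ = h₂ and g₂ = h₁ hold automatically. The content lies in the cubic relations. The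
kernel of the map to As(3) ⊗ Leib(3) splits according to associative words, and a word abc arises
from only two of the three tree shapes, {ab}c and a{bc}. So only those Leibniz relations that
involve two shapes are imposed, namely the copies of R ∩ (U₀ ⊕ U₁). Formally, the action is factored
through As(3) ⊗ Leib(3) by the linear map `pairLift`, with Leib(3) expressed in words through the
Leibniz algebra `leibMul`. An isomorphism with Leib would then give 7 ≤ 6. -/

/-- The value of a tree at `v`, the vertex label `b` being interpreted as the bilinear
operation `op b`. -/
def BTree.value (op : B → MultilinearMap k (fun _ : Fin 2 => A) A) : BTree B I → (I → A) → A
  | .leaf i, v => v i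
  | .node b t, v => op b fun c => (t c).value op v

theorem BTree.value_bind (op : B → MultilinearMap k (fun _ : Fin 2 => A) A) (t : BTree B I)
    (f : I → BTree B J) (v : J → A) :
    (t.bind f).value op v = t.value op fun i => (f i).value op v := by
  induction t with
  | leaf i => rfl
  | node b t ih => simp only [bind, value, ih]

theorem BTree.value_congr (op : B → MultilinearMap k (fun _ : Fin 2 => A) A) (t : BTree B I)
    {v w : I → A} (h : ∀ p, v (t.label p) = w (t.label p)) : t.value op v = t.value op w := by
  induction t with
  | leaf i => exact h ()
  | node b t ih =>
    simp only [value]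
    congr 1
    exact funext fun c => ih c fun p => h ⟨c, p⟩

/-- A variable sits at a single leaf, so only the branch containing that leaf depends on it;
linearity propagates along the path from the leaf to the root. This is what makes a multilinear
monomial a multilinear map. -/
theorem BTree.value_update_aux [DecidableEq I] (op : B → MultilinearMap k (fun _ : Fin 2 => A) A)
    (t : BTree B I) (ht : Function.Injective t.label) (v : I → A) (p : t.Pos) :
    ∃ f : A →ₗ[k] A, ∀ x, t.value op (Function.update v (t.label p) x) = f x := by
  induction t with
  | leaf i => exact ⟨LinearMap.id, fun x => by simp [value, label]⟩
  | node b t ih =>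
    obtain ⟨c, p⟩ := p
    have hc : Function.Injective (t c).label := fun q q' h => by
      have : (⟨c, q⟩ : Σ c, (t c).Pos) = ⟨c, q'⟩ := @ht ⟨c, q⟩ ⟨c, q'⟩ h
      simpa using this
    obtain ⟨f, hf⟩ := ih c hc p
    refine ⟨(op b).toLinearMap (fun d => (t d).value op v) c ∘ₗ f, fun x => ?_⟩
    simp only [value, LinearMap.comp_apply, MultilinearMap.toLinearMap_apply]
    congr 1
    funext d
    rcases eq_or_ne d c with rfl | hd
    · rw [Function.update_self, ← hf]
      rfl
    · rw [Function.update_of_ne hd]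
      refine value_congr op _ fun q => Function.update_of_ne (fun h => hd ?_) _ _
      have := @ht ⟨d, q⟩ ⟨c, p⟩ h
      exact congrArg Sigma.fst this

/-- The multilinear map defined by a multilinear monomial. -/
def MTree.multilinear (op : B → MultilinearMap k (fun _ : Fin 2 => A) A) (t : MTree B I) :
    MultilinearMap k (fun _ : I => A) A where
  toFun v := t.1.value op v
  map_update_add' v i x y := by
    obtain ⟨p, rfl⟩ := t.2.2 i
    obtain ⟨f, hf⟩ := t.1.value_update_aux op t.2.1 v p
    simp only [hf, map_add]
  map_update_smul' v i c x := by
    obtain ⟨p, rfl⟩ := t.2.2 i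
    obtain ⟨f, hf⟩ := t.1.value_update_aux op t.2.1 v p
    simp only [hf, map_smul]

end TreeEval

namespace SymOperad

variable {k : Type u} [Field k]

/-- The structure of an algebra over the operad `P` on the vector space `A`. -/
structure Alg (P : SymOperad k) (A : Type u) [AddCommGroup A] [Module k A] where
  act : ∀ (I : Type) [Finite I], P.obj I →ₗ[k] MultilinearMap k (fun _ : I => A) A
  act_map : ∀ {I J : Type} [Finite I] [Finite J] (e : I ≃ J) (a : P.obj I) (v : J → A),
    act J (P.map e a) v = act I a fun i => v (e i)
  act_one : ∀ v : Unit → A, act Unit P.one v = v ()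
  act_comp : ∀ {I : Type} [Finite I] {J : I → Type} [∀ i, Finite (J i)] (a : P.obj I)
    (b : ∀ i, P.obj (J i)) (v : (Σ i, J i) → A),
    act (Σ i, J i) (P.comp a b) v = act I a fun i => act (J i) (b i) fun j => v ⟨i, j⟩

variable {A : Type u} [AddCommGroup A] [Module k A]

namespace Alg

variable {P : SymOperad k}

theorem act_evalTree (M : Alg P A) {B : Type u} {I : Type} (g : B → P.obj (Fin 2))
    (t : BTree B I) (v : I → A) :
    M.act t.Pos (P.evalTree g t) (fun p => v (t.label p))
      = t.value (fun b => M.act (Fin 2) (g b)) v := by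
  induction t with
  | leaf i => exact M.act_one _
  | node b t ih =>
    refine (M.act_comp (J := fun c => (t c).Pos) (g b) (fun c => P.evalTree g (t c)) _).trans ?_
    simp only [BTree.value]
    congr 1
    exact funext fun c => ih c

theorem act_eval (M : Alg P A) {B : Type u} {I : Type} [Finite I] (g : B → P.obj (Fin 2))
    (t : MTree B I) (v : I → A) :
    M.act I (P.eval g t) v = t.1.value (fun b => M.act (Fin 2) (g b)) v := by
  rw [eval, M.act_map]
  exact M.act_evalTree g t.1 v

/-- The ideal of all elements which act as zero on a `P`-algebra. -/
def annihilator (M : Alg P A) : OpIdeal P where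
  carrier I _ := LinearMap.ker (M.act I)
  map_mem e a h := by
    rw [LinearMap.mem_ker] at h ⊢
    ext v
    rw [M.act_map, h]
    rfl
  comp_mem_left b h := by
    rw [LinearMap.mem_ker] at h ⊢
    ext v
    rw [M.act_comp, h]
    rfl
  comp_mem_right a b i h := by
    rw [LinearMap.mem_ker] at h ⊢
    ext v
    rw [M.act_comp]
    refine (M.act _ a).map_coord_zero i ?_
    rw [h]
    rfl

/-- The annihilator of an algebra is an operadic ideal, so vanishing need only be checked on
generators. A test algebra thus bounds a quotient operad from below without any normal forms. -/
theorem act_eq_zero_of_mem_idealSpan (M : Alg P A) {S : Set (Σ n : ℕ, P.obj (Fin n))}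
    (hS : ∀ x ∈ S, M.act (Fin x.1) x.2 = 0) {I : Type} [Finite I] {a : P.obj I}
    (ha : a ∈ (idealSpan P S).carrier I) : M.act I a = 0 := by
  simp only [idealSpan, Submodule.mem_iInf] at ha
  exact ha M.annihilator hS

/-- An algebra over `P` on which the relations `S` vanish is an algebra over `P / (S)`. -/
noncomputable def descend (M : Alg P A) (S : Set (Σ n : ℕ, P.obj (Fin n)))
    (hS : ∀ x ∈ S, M.act (Fin x.1) x.2 = 0) : Alg (P.quotient (idealSpan P S)) A where
  act I _ := ((idealSpan P S).carrier I).liftQ (M.act I)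
    fun _ ha => M.act_eq_zero_of_mem_idealSpan hS ha
  act_map e a v := by
    obtain ⟨a, rfl⟩ := Submodule.mkQ_surjective _ a
    exact M.act_map e a v
  act_one v := M.act_one v
  act_comp {I} _ {J} _ a b v := by
    obtain ⟨a, rfl⟩ := Submodule.mkQ_surjective _ a
    choose b' hb using fun i => Submodule.mkQ_surjective _ (b i)
    obtain rfl : (fun i => ((idealSpan P S).carrier (J i)).mkQ (b' i)) = b := funext hb
    refine (congrArg (fun z => Submodule.liftQ _ (M.act (Σ i, J i)) _ z v)
      (quotientComp_mk P (idealSpan P S) a b')).trans ?_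
    exact M.act_comp a b' v

end Alg

/-! ### The action of a free operad on a space with bilinear operations -/

section FreeAction

variable {B : Type u} (op : B → MultilinearMap k (fun _ : Fin 2 => A) A)

/-- The action of the free operad on a vector space with bilinear operations `op`. -/
noncomputable def freeAct (I : Type) :
    (MTree B I →₀ k) →ₗ[k] MultilinearMap k (fun _ : I => A) A :=
  Finsupp.linearCombination k fun t : MTree B I => t.multilinear op

theorem freeAct_single {I : Type} (t : MTree B I) (c : k) (v : I → A) :
    freeAct op I (Finsupp.single t c) v = c • t.1.value op v := by
  rw [freeAct, Finsupp.linearCombination_single]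
  rfl

theorem freeAct_relabel {I J : Type} (e : I ≃ J) (a : MTree B I →₀ k) (v : J → A) :
    freeAct op J (Finsupp.lmapDomain k k (MTree.relabel e) a) v
      = freeAct op I a fun i => v (e i) := by
  induction a using Finsupp.induction_linear with
  | zero => simp
  | add a a' h h' => simp only [map_add, add_apply, h, h']
  | single t c =>
    rw [Finsupp.lmapDomain_apply, Finsupp.mapDomain_single, freeAct_single, freeAct_single,
      MTree.relabel, BTree.value_bind]
    rfl

/-- Both sides are linear in `a` and multilinear in `b`, so monomials suffice, and there the claim
is `BTree.value_bind`. -/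
theorem freeAct_comp {I : Type} [Finite I] {J : I → Type} [∀ i, Finite (J i)]
    (a : MTree B I →₀ k) (b : ∀ i, MTree B (J i) →₀ k) (v : (Σ i, J i) → A) :
    freeAct op (Σ i, J i) (freeComp k B a b) v
      = freeAct op I a fun i => freeAct op (J i) (b i) fun j => v ⟨i, j⟩ := by
  induction a using Finsupp.induction_linear with
  | zero => simp
  | add a a' h h' => simp only [map_add, add_apply, h, h']
  | single t r =>
    rw [← mul_one r, ← smul_eq_mul, ← Finsupp.smul_single]
    simp only [map_smul, smul_apply]
    congr 1
    refine congr($(finsupp_multilinear_ext k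
      ((evalMultilinear k v ∘ₗ freeAct op (Σ i, J i)).compMultilinearMap
        (freeComp k B (Finsupp.single t 1)))
      ((freeAct op I (Finsupp.single t 1)).compLinearMap fun i =>
        evalMultilinear k (fun j => v ⟨i, j⟩) ∘ₗ freeAct op (J i)) ?_) b)
    intro u
    simp only [LinearMap.compMultilinearMap_apply, LinearMap.comp_apply,
      MultilinearMap.compLinearMap_apply, freeComp_single]
    simp only [evalMultilinear, LinearMap.coe_mk, AddHom.coe_mk, freeAct_single, one_smul,
      MTree.subst, BTree.value_bind]
    rfl

/-- Algebras over a free operad. -/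
noncomputable def freeAlg : Alg (freeOperad k B) A where
  act I _ := freeAct op I
  act_map e a v := freeAct_relabel op e a v
  act_one v := (freeAct_single op MTree.triv 1 v).trans (one_smul _ _)
  act_comp a b v := freeAct_comp op a b v

end FreeAction

end SymOperad

/-! ### Trees with two or three leaves -/

namespace BTree

variable {B : Type u} {I : Type}

theorem node_eq (b : B) (t : Fin 2 → BTree B I) : node b t = node b ![t 0, t 1] := by
  congr 1
  exact funext (Fin.forall_fin_two.2 ⟨rfl, rfl⟩)

theorem card_pos_node (b : B) (t : Fin 2 → BTree B I) :
    Nat.card (node b t).Pos = Nat.card (t 0).Pos + Nat.card (t 1).Pos := by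
  change Nat.card (Σ c : Fin 2, (t c).Pos) = _
  rw [Nat.card_sigma, Fin.sum_univ_two]

theorem one_le_card_pos (t : BTree B I) : 1 ≤ Nat.card t.Pos := by
  induction t with
  | leaf i => exact Nat.card_pos (α := Unit)
  | node b t ih => exact (ih 0).trans (by rw [card_pos_node]; omega)

theorem eq_leaf_of_card {t : BTree B I} (h : Nat.card t.Pos = 1) : ∃ i, t = leaf i := by
  cases t with
  | leaf i => exact ⟨i, rfl⟩
  | node b t =>
    have h0 := one_le_card_pos (t 0)
    have h1 := one_le_card_pos (t 1)
    rw [card_pos_node] at h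
    omega

theorem eq_node_of_card_two {t : BTree B I} (h : Nat.card t.Pos = 2) :
    ∃ b i j, t = node b ![leaf i, leaf j] := by
  cases t with
  | leaf i => exact absurd ((Nat.card_unique (α := Unit)).symm.trans h) (by decide)
  | node b t =>
    have h0 := one_le_card_pos (t 0)
    have h1 := one_le_card_pos (t 1)
    rw [card_pos_node] at h
    obtain ⟨i, hi⟩ := eq_leaf_of_card (t := t 0) (by omega)
    obtain ⟨j, hj⟩ := eq_leaf_of_card (t := t 1) (by omega)
    exact ⟨b, i, j, by rw [node_eq, hi, hj]⟩

theorem eq_node_of_card_three {t : BTree B I} (h : Nat.card t.Pos = 3) :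
    ∃ b b' i j l, t = node b ![node b' ![leaf i, leaf j], leaf l] ∨
      t = node b ![leaf i, node b' ![leaf j, leaf l]] := by
  cases t with
  | leaf i => exact absurd ((Nat.card_unique (α := Unit)).symm.trans h) (by decide)
  | node b t =>
    have h0 := one_le_card_pos (t 0)
    have h1 := one_le_card_pos (t 1)
    rw [card_pos_node] at h
    obtain h2 | h2 : Nat.card (t 0).Pos = 1 ∨ Nat.card (t 0).Pos = 2 := by omega
    · obtain ⟨i, hi⟩ := eq_leaf_of_card h2
      obtain ⟨b', j, l, hj⟩ := eq_node_of_card_two (t := t 1) (by omega)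
      exact ⟨b, b', i, j, l, Or.inr (by rw [node_eq, hi, hj])⟩
    · obtain ⟨l, hl⟩ := eq_leaf_of_card (t := t 1) (by omega)
      obtain ⟨b', i, j, hj⟩ := eq_node_of_card_two h2
      exact ⟨b, b', i, j, l, Or.inl (by rw [node_eq, hl, hj])⟩

end BTree

namespace MTree

open BTree

variable {B : Type u}

theorem card_pos {I : Type} (t : MTree B I) : Nat.card t.1.Pos = Nat.card I :=
  Nat.card_congr (Equiv.ofBijective _ t.2)

theorem exists_two (t : MTree B (Fin 2)) :
    ∃ b i j, i ≠ j ∧ t.1 = node b ![leaf i, leaf j] := by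
  obtain ⟨t, ht⟩ := t
  obtain ⟨b, i, j, rfl⟩ := eq_node_of_card_two ((card_pos ⟨t, ht⟩).trans (Nat.card_fin 2))
  refine ⟨b, i, j, ?_, rfl⟩
  rintro rfl
  have h : (0 : Fin 2) = 1 := congrArg Sigma.fst (@ht.1 ⟨0, ()⟩ ⟨1, ()⟩ rfl)
  exact absurd h (by decide)

theorem exists_three (t : MTree B (Fin 3)) :
    ∃ b b' i j l, [i, j, l].Nodup ∧ (t.1 = node b ![node b' ![leaf i, leaf j], leaf l] ∨
      t.1 = node b ![leaf i, node b' ![leaf j, leaf l]]) := by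
  -- Three labels exhausting `Fin 3` are distinct, so surjectivity of the labelling is all that is
  -- needed below.
  have aux : ∀ i j l : Fin 3, (∀ m, m = i ∨ m = j ∨ m = l) → [i, j, l].Nodup := by decide
  obtain ⟨t, ht⟩ := t
  obtain ⟨b, b', i, j, l, rfl | rfl⟩ :=
    eq_node_of_card_three ((card_pos ⟨t, ht⟩).trans (Nat.card_fin 3))
  · refine ⟨b, b', i, j, l, aux i j l fun m => ?_, Or.inl rfl⟩
    obtain ⟨⟨c, p⟩, rfl⟩ := ht.2 m
    fin_cases c
    · obtain ⟨c, p⟩ := p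
      fin_cases c
      · exact Or.inl rfl
      · exact Or.inr (Or.inl rfl)
    · exact Or.inr (Or.inr rfl)
  · refine ⟨b, b', i, j, l, aux i j l fun m => ?_, Or.inr rfl⟩
    obtain ⟨⟨c, p⟩, rfl⟩ := ht.2 m
    fin_cases c
    · exact Or.inl rfl
    · obtain ⟨c, p⟩ := p
      fin_cases c
      · exact Or.inr (Or.inl rfl)
      · exact Or.inr (Or.inr rfl)

end MTree

/-! ### The components of arity two and three of the free operad on one operation -/

section Mag

variable (k : Type u) [Field k]

theorem mag_three_induction {p : (magOperad k).obj (Fin 3) → Prop} (zero : p 0)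
    (add : ∀ x y, p x → p y → p (x + y)) (smul : ∀ (c : k) x, p x → p (c • x))
    (left : ∀ i j l h, p (lmon k i j l h)) (right : ∀ i j l h, p (rmon k i j l h))
    (x : (magOperad k).obj (Fin 3)) : p x := by
  refine Finsupp.induction_linear (motive := p) x zero add fun t c => ?_
  have hc : (Finsupp.single t c : MTree PUnit.{u + 1} (Fin 3) →₀ k)
      = c • Finsupp.single t 1 := by simp
  rw [hc]
  refine smul c _ ?_
  obtain ⟨⟨⟩, ⟨⟩, i, j, l, h, ht | ht⟩ := t.exists_three
  · obtain rfl : t = ⟨_, bijective_label_left h⟩ := MTree.ext ht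
    exact left i j l h
  · obtain rfl : t = ⟨_, bijective_label_right h⟩ := MTree.ext ht
    exact right i j l h

theorem nodup_map {i j l : Fin 3} (h : [i, j, l].Nodup) (σ : Equiv.Perm (Fin 3)) :
    [σ i, σ j, σ l].Nodup :=
  h.map σ.injective

theorem exists_perm {i j l : Fin 3} (h : [i, j, l].Nodup) :
    ∃ σ : Equiv.Perm (Fin 3), σ 0 = i ∧ σ 1 = j ∧ σ 2 = l := by
  revert i j l
  decide

theorem map_lmon (σ : Equiv.Perm (Fin 3)) {i j l : Fin 3} (h : [i, j, l].Nodup) :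
    (magOperad k).map σ (lmon k i j l h) = lmon k (σ i) (σ j) (σ l) (nodup_map h σ) := by
  refine (Finsupp.mapDomain_single (f := MTree.relabel σ)).trans ?_
  refine congrArg (fun t => Finsupp.single t (1 : k)) (MTree.ext ?_)
  exact congrArg (BTree.node PUnit.unit)
    (funext (Fin.forall_fin_two.2 ⟨BTree.node_eq PUnit.unit _, rfl⟩))

theorem map_rmon (σ : Equiv.Perm (Fin 3)) {i j l : Fin 3} (h : [i, j, l].Nodup) :
    (magOperad k).map σ (rmon k i j l h) = rmon k (σ i) (σ j) (σ l) (nodup_map h σ) := by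
  refine (Finsupp.mapDomain_single (f := MTree.relabel σ)).trans ?_
  refine congrArg (fun t => Finsupp.single t (1 : k)) (MTree.ext ?_)
  exact congrArg (BTree.node PUnit.unit)
    (funext (Fin.forall_fin_two.2 ⟨rfl, BTree.node_eq PUnit.unit _⟩))

theorem map_leibElt (σ : Equiv.Perm (Fin 3)) {i j l : Fin 3} (h : [i, j, l].Nodup) :
    (magOperad k).map σ (leibElt k i j l h) = leibElt k (σ i) (σ j) (σ l) (nodup_map h σ) := by
  simp only [leibElt, map_add, map_sub, map_lmon, map_rmon]

theorem leibElt_mem {i j l : Fin 3} (h : [i, j, l].Nodup) : leibElt k i j l h ∈ leibRel k := by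
  obtain ⟨σ, rfl, rfl, rfl⟩ := exists_perm h
  exact Submodule.subset_span ⟨σ, _, rfl, (map_leibElt k σ (by decide)).symm⟩

theorem leibRel_eq : leibRel k = Submodule.span k {leibElt k 0 1 2, leibElt k 1 0 2,
    leibElt k 2 1 0, leibElt k 1 2 0, leibElt k 0 2 1, leibElt k 2 0 1} := by
  apply le_antisymm
  · refine Submodule.span_le.2 ?_
    rintro _ ⟨σ, _, rfl, rfl⟩
    rw [map_leibElt k σ (by decide)]
    refine Submodule.subset_span ?_
    have h : [σ 0, σ 1, σ 2].Nodup := nodup_map (by decide) σ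
    change leibElt k (σ 0) (σ 1) (σ 2) h ∈ _
    revert h
    generalize σ 0 = i
    generalize σ 1 = j
    generalize σ 2 = l
    intro h
    fin_cases i <;> fin_cases j <;> fin_cases l <;>
      first
        | exact absurd h (by decide)
        | exact Or.inl rfl
        | exact Or.inr (Or.inl rfl)
        | exact Or.inr (Or.inr (Or.inl rfl))
        | exact Or.inr (Or.inr (Or.inr (Or.inl rfl)))
        | exact Or.inr (Or.inr (Or.inr (Or.inr (Or.inl rfl))))
        | exact Or.inr (Or.inr (Or.inr (Or.inr (Or.inr rfl))))
  · refine Submodule.span_le.2 ?_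
    rintro _ (rfl | rfl | rfl | rfl | rfl | rfl) <;> exact leibElt_mem k (by decide)

/-! ### The intersection of the Leibniz relations with U₀ ⊕ U₁ -/

/-- The encoding of trees in Polish notation. -/
def BTree.code {B : Type u} : BTree B (Fin 3) → List ℕ
  | leaf i => [i.1]
  -- The letter 3 marks an internal vertex; leaves use 0, 1, 2.
  | node _ t => 3 :: ((t 0).code ++ (t 1).code)

/-- The coefficient of the monomials with code `w`. -/
noncomputable def magCoeff (w : List ℕ) : (magOperad k).obj (Fin 3) →ₗ[k] k :=
  Finsupp.lapply w ∘ₗ Finsupp.lmapDomain k k fun t : MTree PUnit.{u + 1} (Fin 3) => t.1.code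

theorem magCoeff_lmon (w : List ℕ) {i j l : Fin 3} (h : [i, j, l].Nodup) :
    magCoeff k w (lmon k i j l h) = if [3, 3, i.1, j.1, l.1] = w then 1 else 0 := by
  change Finsupp.lmapDomain k k (fun t : MTree PUnit.{u + 1} (Fin 3) => t.1.code)
    (Finsupp.single _ 1) w = _
  rw [Finsupp.lmapDomain_apply, Finsupp.mapDomain_single, Finsupp.single_apply]
  rfl

theorem magCoeff_rmon (w : List ℕ) {i j l : Fin 3} (h : [i, j, l].Nodup) :
    magCoeff k w (rmon k i j l h) = if [3, i.1, 3, j.1, l.1] = w then 1 else 0 := by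
  change Finsupp.lmapDomain k k (fun t : MTree PUnit.{u + 1} (Fin 3) => t.1.code)
    (Finsupp.single _ 1) w = _
  rw [Finsupp.lmapDomain_apply, Finsupp.mapDomain_single, Finsupp.single_apply]
  rfl

theorem U₁_eq : U₁ k
    = Submodule.span k {lmon k 2 1 0, lmon k 1 2 0, rmon k 0 2 1, rmon k 0 1 2} := by
  rw [U₁, U₀, Submodule.map_span, Set.image_insert_eq, Set.image_insert_eq, Set.image_pair]
  simp only [map_lmon, map_rmon]
  rfl

/-- The four codes are those of the monomials that multiply `x_0` with `x_2` first, the only shape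
absent from both U₀ and U₁. -/
theorem magCoeff_eq_zero {w : List ℕ}
    (hw : w = [3, 3, 0, 2, 1] ∨ w = [3, 3, 2, 0, 1] ∨ w = [3, 1, 3, 0, 2] ∨ w = [3, 1, 3, 2, 0])
    {x : (magOperad k).obj (Fin 3)} (hx : x ∈ U₀ k ⊔ U₁ k) : magCoeff k w x = 0 := by
  suffices h : U₀ k ⊔ U₁ k ≤ LinearMap.ker (magCoeff k w) from h hx
  rw [U₁_eq, U₀, sup_le_iff, Submodule.span_le, Submodule.span_le]
  constructor <;> rintro _ (rfl | rfl | rfl | rfl) <;>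
    rw [SetLike.mem_coe, LinearMap.mem_ker] <;>
    simp only [magCoeff_lmon, magCoeff_rmon] <;>
    rcases hw with rfl | rfl | rfl | rfl <;> exact if_neg (by decide)

/-- The right-normed terms change sign under exchanging `i` and `j`. What survives is the identity
(ab + ba)c = 0, the only condition an algebra over P(V, F) has to meet. -/
theorem leibElt_add_swap {i j l : Fin 3} (h : [i, j, l].Nodup) (h' : [j, i, l].Nodup) :
    leibElt k i j l h + leibElt k j i l h' = lmon k i j l h + lmon k j i l h' := by
  simp only [leibElt]
  abel

theorem leibRel_inf : leibRel k ⊓ (U₀ k ⊔ U₁ k) = Submodule.span k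
    {leibElt k 0 1 2 + leibElt k 1 0 2, leibElt k 2 1 0 + leibElt k 1 2 0} := by
  apply le_antisymm
  · rintro x ⟨hR, hU⟩
    have h1 := magCoeff_eq_zero k (Or.inl rfl) hU
    have h2 := magCoeff_eq_zero k (Or.inr (Or.inl rfl)) hU
    have h3 := magCoeff_eq_zero k (Or.inr (Or.inr (Or.inl rfl))) hU
    have h4 := magCoeff_eq_zero k (Or.inr (Or.inr (Or.inr rfl))) hU
    rw [leibRel_eq] at hR
    simp only [SetLike.mem_coe, Submodule.mem_span_insert, Submodule.mem_span_singleton] at hR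
    obtain ⟨a, _, ⟨b, _, ⟨c, _, ⟨d, _, ⟨e, _, ⟨f, rfl⟩, rfl⟩, rfl⟩, rfl⟩, rfl⟩, rfl⟩ := hR
    -- The monomials `(x_0 x_2) x_1` and `(x_2 x_0) x_1` each occur in a single generator, which
    -- forces e = f = 0; the coefficients of `x_1 (x_0 x_2)` and `x_1 (x_2 x_0)` are a - b and c -
    -- d.
    simp [leibElt, magCoeff_lmon, magCoeff_rmon] at h1 h2 h3 h4
    subst h1 h2
    obtain rfl : a = b := by linear_combination h3
    obtain rfl : c = d := by linear_combination h4
    rw [Submodule.mem_span_pair]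
    exact ⟨a, c, by module⟩
  · refine Submodule.span_le.2 ?_
    rintro _ (rfl | rfl)
    · refine ⟨add_mem (leibElt_mem k _) (leibElt_mem k _), ?_⟩
      rw [leibElt_add_swap]
      refine Submodule.mem_sup_left (add_mem ?_ ?_)
      · exact Submodule.subset_span (Or.inl rfl)
      · exact Submodule.subset_span (Or.inr (Or.inl rfl))
    · refine ⟨add_mem (leibElt_mem k _) (leibElt_mem k _), ?_⟩
      rw [leibElt_add_swap]
      refine Submodule.mem_sup_right ?_
      rw [U₁_eq]
      refine add_mem ?_ ?_
      · exact Submodule.subset_span (Or.inl rfl)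
      · exact Submodule.subset_span (Or.inr (Or.inl rfl))

/-! ### Finiteness and the upper bound in arity three -/

theorem finite_mag_three : Module.Finite k ((magOperad k).obj (Fin 3)) := by
  refine ⟨Submodule.fg_def.2 ⟨(Set.range fun σ : Equiv.Perm (Fin 3) =>
      lmon k (σ 0) (σ 1) (σ 2) (nodup_map (by decide) σ)) ∪ Set.range fun σ : Equiv.Perm (Fin 3) =>
      rmon k (σ 0) (σ 1) (σ 2) (nodup_map (by decide) σ),
    (Set.finite_range _).union (Set.finite_range _), eq_top_iff.2 fun x _ => ?_⟩⟩
  refine mag_three_induction k (zero_mem _) (fun _ _ => add_mem)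
    (fun c _ => Submodule.smul_mem _ c) ?_ ?_ x
  · intro i j l h
    obtain ⟨σ, rfl, rfl, rfl⟩ := exists_perm h
    exact Submodule.subset_span (Or.inl ⟨σ, rfl⟩)
  · intro i j l h
    obtain ⟨σ, rfl, rfl, rfl⟩ := exists_perm h
    exact Submodule.subset_span (Or.inr ⟨σ, rfl⟩)

theorem finite_quadraticOperad_three (R : Submodule k ((magOperad k).obj (Fin 3))) :
    Module.Finite k ((quadraticOperad k R).obj (Fin 3)) :=
  have := finite_mag_three k
  Module.Finite.of_surjective (SymOperad.toQuotient (magOperad k) _ (Fin 3))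
    (Submodule.mkQ_surjective _)

theorem toQuotient_eq_zero {R : Submodule k ((magOperad k).obj (Fin 3))}
    {x : (magOperad k).obj (Fin 3)} (hx : x ∈ R) :
    SymOperad.toQuotient (magOperad k) (SymOperad.idealSpan _ {x | ∃ r ∈ R, x = ⟨3, r⟩}) (Fin 3) x
      = 0 := by
  refine (Submodule.Quotient.mk_eq_zero _).2 ?_
  simp only [SymOperad.idealSpan, Submodule.mem_iInf]
  exact fun K hK => hK ⟨3, x⟩ ⟨x, hx, rfl⟩

/-- Modulo the Leibniz element every left-normed monomial is a difference of two right-normed ones,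
so the six right-normed monomials span. Their independence plays no role. -/
theorem finrank_leibOperad_three_le : Module.finrank k ((leibOperad k).obj (Fin 3)) ≤ 6 := by
  have key : Submodule.span k (Set.range fun σ : Equiv.Perm (Fin 3) =>
      (SymOperad.toQuotient (magOperad k) _ (Fin 3)
        (rmon k (σ 0) (σ 1) (σ 2) (nodup_map (by decide) σ)) : (leibOperad k).obj (Fin 3)))
      = ⊤ := by
    rw [eq_top_iff]
    rintro x -
    obtain ⟨x, rfl⟩ := Submodule.mkQ_surjective _ x
    change SymOperad.toQuotient (magOperad k) _ (Fin 3) x ∈ _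
    have hr : ∀ i j l h, SymOperad.toQuotient (magOperad k) _ (Fin 3) (rmon k i j l h)
        ∈ Submodule.span k (Set.range fun σ : Equiv.Perm (Fin 3) =>
      (SymOperad.toQuotient (magOperad k) _ (Fin 3)
        (rmon k (σ 0) (σ 1) (σ 2) (nodup_map (by decide) σ)) : (leibOperad k).obj (Fin 3))) := by
      intro i j l h
      obtain ⟨σ, rfl, rfl, rfl⟩ := exists_perm h
      exact Submodule.subset_span ⟨σ, rfl⟩
    refine mag_three_induction k (p := fun x => SymOperad.toQuotient (magOperad k) _ (Fin 3) x
      ∈ Submodule.span k _) ?_ ?_ ?_ ?_ hr x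
    · rw [map_zero]
      exact zero_mem _
    · intro x y hx hy
      rw [map_add]
      exact add_mem hx hy
    · intro c x hx
      rw [map_smul]
      exact Submodule.smul_mem _ c hx
    · intro i j l h
      have h0 := toQuotient_eq_zero k (leibElt_mem k h)
      have h1 : lmon k i j l h = leibElt k i j l h
          + (rmon k i j l h - rmon k j i l (List.Perm.nodup (.swap j i [l]) h)) := by
        simp only [leibElt]
        abel
      rw [h1, map_add, map_sub]
      exact add_mem (by rw [h0]; exact zero_mem _) (sub_mem (hr _ _ _ _) (hr _ _ _ _))
  have h := finrank_range_le_card (R := k) fun σ : Equiv.Perm (Fin 3) =>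
    (SymOperad.toQuotient (magOperad k) _ (Fin 3)
      (rmon k (σ 0) (σ 1) (σ 2) (nodup_map (by decide) σ)) : (leibOperad k).obj (Fin 3))
  rwa [Set.finrank, key, finrank_top, Fintype.card_perm, Fintype.card_fin] at h

end Mag

/-! ### Algebras with one bilinear operation -/

section Binary

variable {k : Type u} [Field k] {A : Type u} [AddCommGroup A] [Module k A]

/-- A bilinear map as a multilinear map on pairs. -/
def binop (f : A →ₗ[k] A →ₗ[k] A) : MultilinearMap k (fun _ : Fin 2 => A) A where
  toFun v := f (v 0) (v 1)
  map_update_add' {dec} v i x y := by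
    obtain rfl : dec = instDecidableEqFin 2 := Subsingleton.elim _ _
    fin_cases i <;> simp
  map_update_smul' {dec} v i c x := by
    obtain rfl : dec = instDecidableEqFin 2 := Subsingleton.elim _ _
    fin_cases i <;> simp

theorem binop_apply (f : A →ₗ[k] A →ₗ[k] A) (v : Fin 2 → A) : binop f v = f (v 0) (v 1) := rfl

open SymOperad

theorem freeAct_lmon (f : A →ₗ[k] A →ₗ[k] A) {i j l : Fin 3} (h : [i, j, l].Nodup)
    (v : Fin 3 → A) :
    (freeAlg fun _ : PUnit.{u + 1} => binop f).act (Fin 3) (lmon k i j l h) v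
      = f (f (v i) (v j)) (v l) :=
  (freeAct_single _ _ _ _).trans (one_smul _ _)

theorem freeAct_rmon (f : A →ₗ[k] A →ₗ[k] A) {i j l : Fin 3} (h : [i, j, l].Nodup)
    (v : Fin 3 → A) :
    (freeAlg fun _ : PUnit.{u + 1} => binop f).act (Fin 3) (rmon k i j l h) v
      = f (v i) (f (v j) (v l)) :=
  (freeAct_single _ _ _ _).trans (one_smul _ _)

theorem act_eq_zero_of_mem_symSpan (M : Alg (magOperad k) A)
    {S : Set ((magOperad k).obj (Fin 3))} (hS : ∀ x ∈ S, M.act (Fin 3) x = 0)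
    {x : (magOperad k).obj (Fin 3)} (hx : x ∈ symSpan k S) : M.act (Fin 3) x = 0 := by
  suffices h : symSpan k S ≤ LinearMap.ker (M.act (Fin 3)) from h hx
  refine Submodule.span_le.2 ?_
  rintro _ ⟨σ, x, hx, rfl⟩
  rw [SetLike.mem_coe, LinearMap.mem_ker]
  ext v
  rw [M.act_map, hS x hx]
  rfl

/-- A bilinear operation satisfying the identities `R` defines an algebra over `P(V, R)`. -/
noncomputable def quadraticAlg (R : Submodule k ((magOperad k).obj (Fin 3)))
    (f : A →ₗ[k] A →ₗ[k] A)
    (hR : ∀ x ∈ R, (freeAlg fun _ : PUnit.{u + 1} => binop f).act (Fin 3) x = 0) :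
    Alg (quadraticOperad k R) A :=
  Alg.descend (freeAlg fun _ : PUnit.{u + 1} => binop f) _
    (by rintro _ ⟨r, hr, rfl⟩; exact hR r hr)

theorem quadraticAlg_act_gen {R : Submodule k ((magOperad k).obj (Fin 3))}
    {f : A →ₗ[k] A →ₗ[k] A}
    (hR : ∀ x ∈ R, (freeAlg fun _ : PUnit.{u + 1} => binop f).act (Fin 3) x = 0) :
    (quadraticAlg R f hR).act (Fin 2) (quadraticGen k R) = binop f := by
  ext v
  exact (freeAct_single (fun _ : PUnit.{u + 1} => binop f) _ _ _).trans (one_smul _ _)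

theorem exists_eq_smul_quadraticGen (R : Submodule k ((magOperad k).obj (Fin 3)))
    (p : (quadraticOperad k R).obj (Fin 2)) : ∃ c d : k, p = c • quadraticGen k R
      + d • (quadraticOperad k R).map (Equiv.swap 0 1) (quadraticGen k R) := by
  have aux : ∀ i j : Fin 2, i ≠ j → (i = 0 ∧ j = 1) ∨ (i = 1 ∧ j = 0) := by decide
  have key : ∀ x : MTree PUnit.{u + 1} (Fin 2) →₀ k, ∃ c d : k,
      x = c • Finsupp.single (MTree.corolla PUnit.unit) (1 : k)
        + d • Finsupp.lmapDomain k k (MTree.relabel (Equiv.swap 0 1))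
          (Finsupp.single (MTree.corolla PUnit.unit) (1 : k)) := by
    intro x
    induction x using Finsupp.induction_linear with
    | zero => exact ⟨0, 0, by rw [zero_smul, zero_smul, add_zero]⟩
    | add x y hx hy =>
      obtain ⟨c, d, rfl⟩ := hx
      obtain ⟨c', d', rfl⟩ := hy
      exact ⟨c + c', d + d', by module⟩
    | single t r =>
      obtain ⟨⟨⟩, i, j, hij, ht⟩ := t.exists_two
      obtain ⟨rfl, rfl⟩ | ⟨rfl, rfl⟩ := aux i j hij
      · have : t = MTree.corolla PUnit.unit := MTree.ext (ht.trans (BTree.node_eq _ _).symm)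
        exact ⟨r, 0, by rw [zero_smul, add_zero, this, Finsupp.smul_single, smul_eq_mul, mul_one]⟩
      · have : t = (MTree.corolla PUnit.unit).relabel (Equiv.swap 0 1) :=
          MTree.ext (ht.trans
            (BTree.node_eq PUnit.unit fun c => BTree.leaf (Equiv.swap (0 : Fin 2) 1 c)).symm)
        exact ⟨0, r, by rw [zero_smul, zero_add, this, Finsupp.lmapDomain_apply,
          Finsupp.mapDomain_single, Finsupp.smul_single, smul_eq_mul, mul_one]⟩
  obtain ⟨x, rfl⟩ := Submodule.mkQ_surjective _ p
  obtain ⟨c, d, rfl⟩ := key x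
  exact ⟨c, d, rfl⟩

theorem exists_quadraticAlg_act_eq {R : Submodule k ((magOperad k).obj (Fin 3))}
    {f : A →ₗ[k] A →ₗ[k] A}
    (hR : ∀ x ∈ R, (freeAlg fun _ : PUnit.{u + 1} => binop f).act (Fin 3) x = 0)
    (p : (quadraticOperad k R).obj (Fin 2)) :
    ∃ c d : k, (quadraticAlg R f hR).act (Fin 2) p = c • binop f + d • binop f.flip := by
  obtain ⟨c, d, rfl⟩ := exists_eq_smul_quadraticGen R p
  refine ⟨c, d, ?_⟩
  rw [map_add, map_smul, map_smul, quadraticAlg_act_gen]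
  congr 2
  ext v
  rw [Alg.act_map, quadraticAlg_act_gen]
  rfl

end Binary

/-! ### Words -/

section Words

variable (k : Type u) [Field k]

/-- The free associative algebra on variables indexed by `ℕ`. -/
abbrev WordAlg : Type u := MonoidAlgebra k (FreeMonoid ℕ)

/-- A word. -/
noncomputable def word (w : List ℕ) : WordAlg k := MonoidAlgebra.single (FreeMonoid.ofList w) 1

theorem word_mul (w w' : List ℕ) : word k w * word k w' = word k (w ++ w') := by
  rw [word, word, MonoidAlgebra.single_mul_single, one_mul]
  rfl

/-- The linear extension of a map defined on words. -/
noncomputable def wordLift {N : Type u} [AddCommGroup N] [Module k N] (c : List ℕ → N) :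
    WordAlg k →ₗ[k] N :=
  Finsupp.linearCombination k (fun w : FreeMonoid ℕ => c w.toList)
    ∘ₗ (MonoidAlgebra.coeffLinearEquiv k).toLinearMap

theorem wordLift_word {N : Type u} [AddCommGroup N] [Module k N] (c : List ℕ → N) (w : List ℕ) :
    wordLift k c (word k w) = c w := by
  change Finsupp.linearCombination k (fun w : FreeMonoid ℕ => c w.toList)
    (Finsupp.single (FreeMonoid.ofList w) 1) = _
  rw [Finsupp.linearCombination_single, one_smul]
  rfl

/-- The coefficient of a word. -/
noncomputable def wordCoeff (w : List ℕ) : WordAlg k →ₗ[k] k :=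
  wordLift k fun w' => if w' = w then 1 else 0

theorem wordCoeff_word (w w' : List ℕ) :
    wordCoeff k w (word k w') = if w' = w then 1 else 0 :=
  wordLift_word k _ _

open SymOperad

theorem mul_asRel (x : (magOperad k).obj (Fin 3)) (hx : x ∈ asRel k) :
    (freeAlg fun _ : PUnit.{u + 1} => binop (LinearMap.mul k (WordAlg k))).act (Fin 3) x = 0 := by
  refine act_eq_zero_of_mem_symSpan _ ?_ hx
  rintro _ rfl
  ext v
  rw [map_sub, sub_apply, freeAct_lmon, freeAct_rmon]
  simp only [LinearMap.mul_apply', mul_assoc, sub_self]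
  rfl

/-- The algebra of words as an algebra over the associative operad. -/
noncomputable def asAlg : Alg (asOperad k) (WordAlg k) :=
  quadraticAlg (asRel k) (LinearMap.mul k (WordAlg k)) (mul_asRel k)

/-- The Leibniz product `(X, m) (Y, n) = ([X, Y], X n)`. -/
noncomputable def leibMul : (WordAlg k × WordAlg k) →ₗ[k] (WordAlg k × WordAlg k) →ₗ[k]
    (WordAlg k × WordAlg k) :=
  LinearMap.mk₂ k (fun a b => (a.1 * b.1 - b.1 * a.1, a.1 * b.2))
    (fun _ _ _ => by ext1 <;> simp only [Prod.fst_add, Prod.snd_add] <;> noncomm_ring)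
    (fun _ _ _ => by ext1 <;> simp [smul_sub])
    (fun _ _ _ => by ext1 <;> simp only [Prod.fst_add, Prod.snd_add] <;> noncomm_ring)
    (fun _ _ _ => by ext1 <;> simp [smul_sub])

theorem leibMul_apply (a b : WordAlg k × WordAlg k) :
    leibMul k a b = (a.1 * b.1 - b.1 * a.1, a.1 * b.2) := rfl

/-- This is the associative algebra with its commutator bracket, acting on a left module: the first
component is the Jacobi identity, the second is [X, Y]n = X(Yn) - Y(Xn). At `leibPoint` the second
component sends `x_i (x_j x_l)` to the word ijl and `(x_i x_j) x_l` to ijl - jil. -/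
theorem leibMul_leibRel (x : (magOperad k).obj (Fin 3)) (hx : x ∈ leibRel k) :
    (freeAlg fun _ : PUnit.{u + 1} => binop (leibMul k)).act (Fin 3) x = 0 := by
  refine act_eq_zero_of_mem_symSpan _ ?_ hx
  rintro _ rfl
  ext v : 1
  rw [leibElt, map_add, map_sub, add_apply, sub_apply, freeAct_lmon, freeAct_rmon, freeAct_rmon]
  simp only [leibMul_apply]
  ext1
  · simp only [Prod.fst_add, Prod.fst_sub, zero_apply, Prod.fst_zero]
    noncomm_ring
  · simp only [Prod.snd_add, Prod.snd_sub, zero_apply, Prod.snd_zero]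
    noncomm_ring

/-- A Leibniz algebra. -/
noncomputable def leibAlg : Alg (leibOperad k) (WordAlg k × WordAlg k) :=
  quadraticAlg (leibRel k) (leibMul k) (leibMul_leibRel k)

/-- A generic point of the algebra of words. -/
noncomputable def asPoint (n : ℕ) (i : Fin n) : WordAlg k := word k [i.1]

/-- A generic point of `leibAlg`. -/
noncomputable def leibPoint (n : ℕ) (i : Fin n) : WordAlg k × WordAlg k :=
  (word k [i.1], word k [i.1])

/-- Evaluation at the generic point of the algebra of words. -/
noncomputable def asEval (n : ℕ) : (asOperad k).obj (Fin n) →ₗ[k] WordAlg k :=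
  evalMultilinear k (asPoint k n) ∘ₗ (asAlg k).act (Fin n)

/-- The second component of the evaluation at the generic point of `leibAlg`. -/
noncomputable def leibEval (n : ℕ) : (leibOperad k).obj (Fin n) →ₗ[k] WordAlg k :=
  LinearMap.snd k _ _ ∘ₗ evalMultilinear k (leibPoint k n) ∘ₗ (leibAlg k).act (Fin n)

/-- The coefficient of `x_0 x_1`. -/
noncomputable def asCoeff : (asOperad k).obj (Fin 2) →ₗ[k] k := wordCoeff k [0, 1] ∘ₗ asEval k 2

/-- The coefficient of `x_1 x_0`. -/
noncomputable def asCoeffSwap : (asOperad k).obj (Fin 2) →ₗ[k] k :=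
  wordCoeff k [1, 0] ∘ₗ asEval k 2

/-- The coefficient of `x_0 x_1`. -/
noncomputable def leibCoeff : (leibOperad k).obj (Fin 2) →ₗ[k] k :=
  wordCoeff k [0, 1] ∘ₗ leibEval k 2

/-- The coefficient of `x_1 x_0`. -/
noncomputable def leibCoeffSwap : (leibOperad k).obj (Fin 2) →ₗ[k] k :=
  wordCoeff k [1, 0] ∘ₗ leibEval k 2

/-- At the generic point the product and its opposite give different words, so both coefficients can
be read off from the action. -/
theorem asCoeff_eq {p : (asOperad k).obj (Fin 2)} {c d : k}
    (h : (asAlg k).act (Fin 2) p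
      = c • binop (LinearMap.mul k (WordAlg k)) + d • binop (LinearMap.mul k (WordAlg k)).flip) :
    asCoeff k p = c ∧ asCoeffSwap k p = d := by
  have h1 : asEval k 2 p = c • word k [0, 1] + d • word k [1, 0] := by
    change (asAlg k).act (Fin 2) p (asPoint k 2) = _
    rw [h]
    simp [binop_apply, asPoint, word_mul]
  simp [asCoeff, asCoeffSwap, h1, wordCoeff_word]

theorem leibCoeff_eq {p : (leibOperad k).obj (Fin 2)} {c d : k}
    (h : (leibAlg k).act (Fin 2) p = c • binop (leibMul k) + d • binop (leibMul k).flip) :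
    leibCoeff k p = c ∧ leibCoeffSwap k p = d := by
  have h1 : leibEval k 2 p = c • word k [0, 1] + d • word k [1, 0] := by
    change ((leibAlg k).act (Fin 2) p (leibPoint k 2)).2 = _
    rw [h]
    simp [binop_apply, leibPoint, leibMul_apply, word_mul]
  simp [leibCoeff, leibCoeffSwap, h1, wordCoeff_word]

theorem asAlg_act (p : (asOperad k).obj (Fin 2)) :
    (asAlg k).act (Fin 2) p = asCoeff k p • binop (LinearMap.mul k (WordAlg k))
      + asCoeffSwap k p • binop (LinearMap.mul k (WordAlg k)).flip := by
  obtain ⟨c, d, h⟩ := exists_quadraticAlg_act_eq (mul_asRel k) p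
  obtain ⟨h1, h2⟩ := asCoeff_eq k h
  rw [h1, h2]
  exact h

theorem leibAlg_act (p : (leibOperad k).obj (Fin 2)) :
    (leibAlg k).act (Fin 2) p
      = leibCoeff k p • binop (leibMul k) + leibCoeffSwap k p • binop (leibMul k).flip := by
  obtain ⟨c, d, h⟩ := exists_quadraticAlg_act_eq (leibMul_leibRel k) p
  obtain ⟨h1, h2⟩ := leibCoeff_eq k h
  rw [h1, h2]
  exact h

theorem asCoeff_gen : asCoeff k (quadraticGen k (asRel k)) = 1 ∧
    asCoeffSwap k (quadraticGen k (asRel k)) = 0 :=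
  asCoeff_eq k ((quadraticAlg_act_gen (mul_asRel k)).trans (by rw [one_smul, zero_smul, add_zero]))

theorem leibCoeff_gen : leibCoeff k (quadraticGen k (leibRel k)) = 1 ∧
    leibCoeffSwap k (quadraticGen k (leibRel k)) = 0 :=
  leibCoeff_eq k ((quadraticAlg_act_gen (leibMul_leibRel k)).trans (by rw [one_smul, zero_smul, add_zero]))

theorem leibCoeff_gen_swap :
    leibCoeff k ((leibOperad k).map (Equiv.swap 0 1) (quadraticGen k (leibRel k))) = 0 ∧
    leibCoeffSwap k ((leibOperad k).map (Equiv.swap 0 1) (quadraticGen k (leibRel k))) = 1 := by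
  refine leibCoeff_eq k ?_
  rw [zero_smul, one_smul, zero_add]
  ext1 v
  rw [Alg.act_map, leibAlg, quadraticAlg_act_gen]
  rfl

end Words

/-! ### The criterion operad and its algebra -/

section Criterion

variable (k : Type u) [Field k]

/-- The vector space of an algebra over `P(V, F)`. -/
abbrev CritAlg : Type u := (WordAlg k × WordAlg k) × (WordAlg k × WordAlg k)

/-- A product satisfying `(a b + b a) c = 0`. -/
noncomputable def critMul : CritAlg k →ₗ[k] CritAlg k →ₗ[k] CritAlg k :=
  LinearMap.mk₂ k
    (fun a b => ((0, a.1.1 * b.1.1 - b.1.1 * a.1.1), (a.1.1 * b.2.1, a.1.2 * b.2.2)))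
    (fun _ _ _ => by ext1 <;> ext1 <;> (simp [add_mul, mul_add]; try abel))
    (fun _ _ _ => by ext1 <;> ext1 <;> simp [smul_sub])
    (fun _ _ _ => by ext1 <;> ext1 <;> (simp [add_mul, mul_add]; try abel))
    (fun _ _ _ => by ext1 <;> ext1 <;> simp [smul_sub])

theorem critMul_apply (a b : CritAlg k) : critMul k a b
    = ((0, a.1.1 * b.1.1 - b.1.1 * a.1.1), (a.1.1 * b.2.1, a.1.2 * b.2.2)) := rfl

/-- A product has 0 in the first of its four slots and a commutator in the second. Multiplying by it
on the left therefore uses only the commutator, which is antisymmetric. -/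
theorem critMul_critMul (a b c : CritAlg k) :
    critMul k (critMul k a b) c = -critMul k (critMul k b a) c := by
  ext1 <;> ext1 <;> simp [critMul_apply, ← neg_mul]

open SymOperad

theorem critMul_criterionSubmodule (x : (magOperad k).obj (Fin 3))
    (hx : x ∈ criterionSubmodule k (leibRel k)) :
    (freeAlg fun _ : PUnit.{u + 1} => binop (critMul k)).act (Fin 3) x = 0 := by
  refine act_eq_zero_of_mem_symSpan _ (fun y hy => ?_) hx
  rw [leibRel_inf] at hy
  suffices h : Submodule.span k
      {leibElt k 0 1 2 + leibElt k 1 0 2, leibElt k 2 1 0 + leibElt k 1 2 0}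
      ≤ LinearMap.ker ((freeAlg fun _ : PUnit.{u + 1} => binop (critMul k)).act (Fin 3)) from h hy
  refine Submodule.span_le.2 ?_
  rintro _ (rfl | rfl) <;> rw [SetLike.mem_coe, LinearMap.mem_ker, leibElt_add_swap] <;>
    ext1 v <;> rw [map_add, add_apply, freeAct_lmon, freeAct_lmon, critMul_critMul,
      neg_add_cancel] <;> rfl

/-- An algebra over `P(V, F)`. -/
noncomputable def critAlg :
    Alg (quadraticOperad k (criterionSubmodule k (leibRel k))) (CritAlg k) :=
  quadraticAlg _ (critMul k) (critMul_criterionSubmodule k)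

/-- A generic point of `CritAlg`. -/
noncomputable def critPoint (i : Fin 3) : CritAlg k :=
  ((word k [i.1], 0), (word k [i.1], word k [i.1]))

/-- Seven coordinates of elements of `CritAlg`. -/
noncomputable def critCoord : CritAlg k →ₗ[k] (Option (Equiv.Perm (Fin 3)) → k) :=
  LinearMap.pi fun o => o.elim (wordCoeff k [0, 1, 2] ∘ₗ LinearMap.snd k _ _ ∘ₗ LinearMap.snd k _ _)
    fun σ => wordCoeff k [(σ 0).1, (σ 1).1, (σ 2).1] ∘ₗ LinearMap.fst k _ _ ∘ₗ LinearMap.snd k _ _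

/-- Generic points vanish in the second slot and products in the first. Hence right-normed monomials
appear as plain words in the third slot and left-normed ones only in the fourth; this decoupling
keeps the seven values independent. -/
theorem critCoord_right (σ : Equiv.Perm (Fin 3)) :
    critCoord k (critMul k (critPoint k (σ 0)) (critMul k (critPoint k (σ 1)) (critPoint k (σ 2))))
      = Pi.single (some σ) 1 := by
  have aux : ∀ σ τ : Equiv.Perm (Fin 3), σ 0 = τ 0 → σ 1 = τ 1 → σ 2 = τ 2 → σ = τ := by
    intro σ τ h0 h1 h2
    ext i : 1
    fin_cases i <;> assumption
  ext o
  cases o with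
  | none => simp [critCoord, critPoint, critMul_apply]
  | some τ =>
    rw [Pi.single_apply]
    simp only [critCoord, critPoint, critMul_apply, LinearMap.pi_apply, Option.elim_some,
      LinearMap.comp_apply, LinearMap.fst_apply, LinearMap.snd_apply, word_mul, wordCoeff_word]
    refine if_congr ⟨fun h => ?_, fun h => ?_⟩ rfl rfl
    · simp only [List.cons_append, List.nil_append, List.cons.injEq, and_true] at h
      exact congrArg some (aux _ _ (Fin.ext h.1) (Fin.ext h.2.1) (Fin.ext h.2.2)).symm
    · obtain rfl := Option.some.inj h
      rfl

theorem critCoord_left :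
    critCoord k (critMul k (critMul k (critPoint k 0) (critPoint k 1)) (critPoint k 2))
      = Pi.single none 1 := by
  ext o
  cases o with
  | none => simp [critCoord, critPoint, critMul_apply, word_mul, wordCoeff_word, sub_mul]
  | some τ => simp [critCoord, critPoint, critMul_apply]

/-- Formulated for an arbitrary operad so as to serve both P(V, F) and the quotient of the white
product. The monomials in `h`, six right-normed and one left-normed, take the seven basis vectors as
values. -/
theorem seven_le_finrank {P : SymOperad k} (M : Alg P (CritAlg k)) (h : P.obj (Fin 2))
    (hM : M.act (Fin 2) h = binop (critMul k)) [Module.Finite k (P.obj (Fin 3))] :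
    7 ≤ Module.finrank k (P.obj (Fin 3)) := by
  let T : P.obj (Fin 3) →ₗ[k] (Option (Equiv.Perm (Fin 3)) → k) :=
    critCoord k ∘ₗ evalMultilinear k (critPoint k) ∘ₗ M.act (Fin 3)
  have hT : Function.Surjective T := by
    rw [← LinearMap.range_eq_top, eq_top_iff, ← (Pi.basisFun k _).span_eq, Submodule.span_le]
    rintro _ ⟨o, rfl⟩
    rw [Pi.basisFun_apply]
    cases o with
    | none =>
      refine ⟨P.eval (fun _ : PUnit.{u + 1} => h) ⟨_, bijective_label_left (i := 0) (j := 1)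
        (l := 2) (by decide)⟩, ?_⟩
      rw [← critCoord_left]
      refine congrArg (critCoord k) ((M.act_eval _ _ _).trans ?_)
      simp only [hM]
      rfl
    | some σ =>
      refine ⟨P.eval (fun _ : PUnit.{u + 1} => h) ⟨_, bijective_label_right (i := σ 0) (j := σ 1)
        (l := σ 2) (nodup_map (by decide) σ)⟩, ?_⟩
      rw [← critCoord_right]
      refine congrArg (critCoord k) ((M.act_eval _ _ _).trans ?_)
      simp only [hM]
      rfl
  have := LinearMap.finrank_le_finrank_of_surjective hT
  rwa [Module.finrank_fintype_fun_eq_card, Fintype.card_option, Fintype.card_perm,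
    Fintype.card_fin] at this

theorem seven_le_finrank_criterion : 7 ≤ Module.finrank k
    ((quadraticOperad k (criterionSubmodule k (leibRel k))).obj (Fin 3)) :=
  have := finite_quadraticOperad_three k (criterionSubmodule k (leibRel k))
  seven_le_finrank k (critAlg k) _ (quadraticAlg_act_gen (critMul_criterionSubmodule k))

/-! ### The action of the white product -/

/-- The generators of the white product of the associative and the Leibniz operad. -/
abbrev WhiteGens : Type u := (asOperad k).obj (Fin 2) × (leibOperad k).obj (Fin 2)

/-- The action of `p ⊗ q` on `CritAlg`. -/
noncomputable def whiteOp (b : WhiteGens k) : MultilinearMap k (fun _ : Fin 2 => CritAlg k)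
    (CritAlg k) :=
  -- The coefficient sum is the map from As(2) to the commutative operad: it does not separate `x_0
  -- x_1 ⊗ q` from `x_1 x_0 ⊗ q`, as the identifications g₁ = h₂ and g₂ = h₁ demand.
  (asCoeff k b.1 + asCoeffSwap k b.1) •
    (leibCoeff k b.2 • binop (critMul k) + leibCoeffSwap k b.2 • binop (critMul k).flip)

theorem whiteOp_apply (b : WhiteGens k) (v : Fin 2 → CritAlg k) :
    whiteOp k b v = (asCoeff k b.1 + asCoeffSwap k b.1) •
      (leibCoeff k b.2 • critMul k (v 0) (v 1) + leibCoeffSwap k b.2 • critMul k (v 1) (v 0)) :=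
  rfl

/-- The linear map on `As(n) ⊗ Leib(n)` determined by its values on pairs of words. -/
noncomputable def pairLift (n : ℕ) (c : List ℕ → List ℕ → CritAlg k) :
    (asOperad k).obj (Fin n) ⊗[k] (leibOperad k).obj (Fin n) →ₗ[k] CritAlg k :=
  TensorProduct.lift (wordLift k fun s => wordLift k (c s)) ∘ₗ
    TensorProduct.map (asEval k n) (leibEval k n)

theorem pairLift_tmul (n : ℕ) (c : List ℕ → List ℕ → CritAlg k) (a : (asOperad k).obj (Fin n))
    (b : (leibOperad k).obj (Fin n)) : pairLift k n c (a ⊗ₜ b)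
      = wordLift k (fun s => wordLift k (c s)) (asEval k n a) (leibEval k n b) := rfl

theorem asEval_eval (n : ℕ) (t : MTree (WhiteGens k) (Fin n)) :
    asEval k n ((asOperad k).eval Prod.fst t)
      = t.1.value (fun b => asCoeff k b.1 • binop (LinearMap.mul k (WordAlg k))
        + asCoeffSwap k b.1 • binop (LinearMap.mul k (WordAlg k)).flip) (asPoint k n) := by
  simp only [← asAlg_act]
  exact (asAlg k).act_eval _ _ _

theorem leibEval_eval (n : ℕ) (t : MTree (WhiteGens k) (Fin n)) :
    leibEval k n ((leibOperad k).eval Prod.snd t)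
      = (t.1.value (fun b => leibCoeff k b.2 • binop (leibMul k)
        + leibCoeffSwap k b.2 • binop (leibMul k).flip) (leibPoint k n)).2 := by
  simp only [← leibAlg_act]
  exact congrArg Prod.snd ((leibAlg k).act_eval _ _ _)

/-- Once the action of monomials factors linearly through As(n) ⊗ Leib(n), the kernel of
`evalTensor` must act as zero. The two evaluations in words need not be injective for this. -/
theorem freeAct_eq_zero_of_pairLift (n : ℕ) (v : Fin n → CritAlg k)
    (c : List ℕ → List ℕ → CritAlg k)
    (h : ∀ t : MTree (WhiteGens k) (Fin n), t.1.value (whiteOp k) v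
      = pairLift k n c ((asOperad k).eval Prod.fst t ⊗ₜ (leibOperad k).eval Prod.snd t))
    {x : MTree (WhiteGens k) (Fin n) →₀ k}
    (hx : evalTensor (asOperad k) (leibOperad k) (Fin n) x = 0) :
    freeAct (whiteOp k) (Fin n) x v = 0 := by
  have key : evalMultilinear k v ∘ₗ freeAct (whiteOp k) (Fin n)
      = pairLift k n c ∘ₗ (evalTensor (asOperad k) (leibOperad k) (Fin n) :
        (MTree (WhiteGens k) (Fin n) →₀ k) →ₗ[k] _) := by
    refine finsupp_linear_ext k _ _ fun t => ?_
    refine ((freeAct_single (whiteOp k) t 1 v).trans (one_smul _ _)).trans ((h t).trans ?_)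
    refine congrArg (pairLift k n c) ?_
    refine .trans ?_ (Finsupp.linearCombination_single k _ _).symm
    rw [one_smul]
  have h2 := congrArg (fun f => f x) key
  refine h2.trans ?_
  change pairLift k n c (evalTensor (asOperad k) (leibOperad k) (Fin n) x) = 0
  rw [hx, map_zero]

/-- The values of `pairLift` in arity two. -/
noncomputable def pairValueTwo (u : ℕ → CritAlg k) : List ℕ → List ℕ → CritAlg k
  -- The associative word is ignored, in accordance with the coefficient sum in `whiteOp`.
  | _, [a, b] => critMul k (u a) (u b)
  | _, _ => 0

/-- The values of `pairLift` in arity three. -/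
noncomputable def pairValueThree (u : ℕ → CritAlg k) : List ℕ → List ℕ → CritAlg k
  | [a, b, c], w =>
    if w = [a, b, c] then critMul k (u a) (critMul k (u b) (u c))
    -- The word bac stands for b(ac), a shape that the associative word abc does not allow; its
    -- value is forced by (ab)c = abc - bac. Likewise bca is forced by (cb)a = cba - bca.
    else if w = [b, a, c] then
      critMul k (u a) (critMul k (u b) (u c)) - critMul k (critMul k (u a) (u b)) (u c)
    else if w = [c, a, b] then critMul k (u c) (critMul k (u a) (u b))
    else if w = [c, b, a] then critMul k (u c) (critMul k (u b) (u a))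
    else if w = [b, c, a] then
      critMul k (u c) (critMul k (u b) (u a)) - critMul k (critMul k (u c) (u b)) (u a)
    else if w = [a, c, b] then critMul k (u a) (critMul k (u c) (u b))
    else 0
  | _, _ => 0

theorem freeAct_eq_zero_two {x : MTree (WhiteGens k) (Fin 2) →₀ k}
    (hx : evalTensor (asOperad k) (leibOperad k) (Fin 2) x = 0) :
    freeAct (whiteOp k) (Fin 2) x = 0 := by
  ext1 v
  -- The point is extended by 0 to all naturals because the letters of words are naturals.
  obtain ⟨u, rfl⟩ : ∃ u : ℕ → CritAlg k, v = fun i => u i.1 :=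
    ⟨fun n => if h : n < 2 then v ⟨n, h⟩ else 0, by ext1 i; beta_reduce; rw [dif_pos i.2]⟩
  refine freeAct_eq_zero_of_pairLift k 2 _ (pairValueTwo k u) (fun t => ?_) hx
  obtain ⟨b, i, j, hij, ht⟩ := t.exists_two
  rw [pairLift_tmul, asEval_eval, leibEval_eval, ht]
  simp [BTree.value, whiteOp_apply, binop_apply, leibMul_apply, asPoint, leibPoint, word_mul,
    wordLift_word, pairValueTwo]
  module

/-- For a fixed associative word abc, eight monomials of the shapes {ab}c and a{bc} must receive
their values from six Leibniz words. `pairValueThree` is built to fit the four right-normed ones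
together with (ab)c and (cb)a; the remaining (ba)c and (bc)a come out right exactly because (ab +
ba)c = 0, which is where `critMul_critMul` enters. -/
theorem freeAct_eq_zero_three {x : MTree (WhiteGens k) (Fin 3) →₀ k}
    (hx : evalTensor (asOperad k) (leibOperad k) (Fin 3) x = 0) :
    freeAct (whiteOp k) (Fin 3) x = 0 := by
  ext1 v
  obtain ⟨u, rfl⟩ : ∃ u : ℕ → CritAlg k, v = fun i => u i.1 :=
    ⟨fun n => if h : n < 3 then v ⟨n, h⟩ else 0, by ext1 i; beta_reduce; rw [dif_pos i.2]⟩
  refine freeAct_eq_zero_of_pairLift k 3 _ (pairValueThree k u) (fun t => ?_) hx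
  obtain ⟨b, b', i, j, l, h, ht⟩ := t.exists_three
  have hij : i.1 ≠ j.1 := fun h' => by simp [Fin.ext h'] at h
  have hil : i.1 ≠ l.1 := fun h' => by simp [Fin.ext h'] at h
  have hjl : j.1 ≠ l.1 := fun h' => by simp [Fin.ext h'] at h
  rw [pairLift_tmul, asEval_eval, leibEval_eval]
  rcases ht with ht | ht <;> rw [ht]
  · simp [BTree.value, whiteOp_apply, binop_apply, leibMul_apply, asPoint, leibPoint, word_mul,
      wordLift_word, pairValueThree, hij, hij.symm, hil, hil.symm, hjl, hjl.symm, sub_mul, mul_sub,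
      add_mul, mul_add, critMul_critMul k (u j) (u i) (u l)]
    module
  · simp [BTree.value, whiteOp_apply, binop_apply, leibMul_apply, asPoint, leibPoint, word_mul,
      wordLift_word, pairValueThree, hij, hij.symm, hil, hil.symm, hjl, hjl.symm, sub_mul, mul_sub,
      add_mul, mul_add, critMul_critMul k (u l) (u j) (u i)]
    module

/-- The algebra over the white product of the associative and the Leibniz operad. -/
noncomputable def whiteAlg : Alg ((asOperad k).whiteProduct (leibOperad k)) (CritAlg k) :=
  Alg.descend (freeAlg (whiteOp k)) _ (by
    rintro ⟨n, x⟩ ⟨h | h, hx⟩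
    · obtain rfl : n = 2 := h
      exact freeAct_eq_zero_two k hx
    · obtain rfl : n = 3 := h
      exact freeAct_eq_zero_three k hx)

theorem whiteAlg_act_whiteGen (p : (asOperad k).obj (Fin 2)) (q : (leibOperad k).obj (Fin 2)) :
    (whiteAlg k).act (Fin 2) (whiteGen _ _ p q) = whiteOp k (p, q) := by
  ext1 v
  exact (freeAct_single (whiteOp k) _ _ _).trans (one_smul _ _)

theorem whiteAlg_act_genH : (whiteAlg k).act (Fin 2)
    (genH k (leibOperad k) (quadraticGen k (leibRel k))) = binop (critMul k) := by
  rw [genH, whiteAlg_act_whiteGen, whiteOp, (asCoeff_gen k).1, (asCoeff_gen k).2,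
    (leibCoeff_gen k).1, (leibCoeff_gen k).2]
  module

theorem whiteAlg_act_genG : (whiteAlg k).act (Fin 2)
    (genG k (leibOperad k) (quadraticGen k (leibRel k))) = binop (critMul k).flip := by
  rw [genG, whiteAlg_act_whiteGen, whiteOp, (asCoeff_gen k).1, (asCoeff_gen k).2,
    (leibCoeff_gen_swap k).1, (leibCoeff_gen_swap k).2]
  module

/-- The algebra over the quotient of the white product by `g₁ = h₂` and `g₂ = h₁`. -/
noncomputable def identifiedAlg :
    Alg (identifiedOperad k (leibOperad k) (quadraticGen k (leibRel k))) (CritAlg k) :=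
  Alg.descend (whiteAlg k) _ (by
    rintro _ (rfl | rfl)
    · ext1 v
      rw [map_sub, sub_apply, Alg.act_map, whiteAlg_act_genG, whiteAlg_act_genH]
      exact sub_self _
    · ext1 v
      rw [map_sub, sub_apply, Alg.act_map, whiteAlg_act_genG, whiteAlg_act_genH]
      exact sub_self _)

theorem not_admitsNonsymmetricVersion_leib :
    ¬ AdmitsNonsymmetricVersion k (leibOperad k) (quadraticGen k (leibRel k)) := by
  rintro ⟨φ⟩
  have := finite_quadraticOperad_three k (leibRel k)
  -- Finiteness is carried across the isomorphism first: `finrank` is 0 on an infinite-dimensional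
  -- space, so the bound by seven needs it.
  have := Module.Finite.equiv (φ.toEquiv (Fin 3)).symm
  have h := seven_le_finrank k (identifiedAlg k)
    (toQuotient _ _ (Fin 2) (genH k (leibOperad k) (quadraticGen k (leibRel k))))
    (whiteAlg_act_genH k)
  rw [(φ.toEquiv (Fin 3)).finrank_eq] at h
  have := finrank_leibOperad_three_le k
  omega

end Criterion

theorem mainTheorem3 (k : Type u) [Field k] :
    leibRel k ⊓ (U₀ k ⊔ U₁ k)
        = Submodule.span k
          {leibElt k 0 1 2 + leibElt k 1 0 2, leibElt k 2 1 0 + leibElt k 1 2 0} ∧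
      Module.finrank k ((leibOperad k).obj (Fin 3))
        < Module.finrank k ((quadraticOperad k (criterionSubmodule k (leibRel k))).obj (Fin 3)) ∧
      ¬ AdmitsNonsymmetricVersion k (leibOperad k) (quadraticGen k (leibRel k)) :=
  ⟨leibRel_inf k, (finrank_leibOperad_three_le k).trans_lt (seven_le_finrank_criterion k),
    not_admitsNonsymmetricVersion_leib k⟩
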